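/- **Language.** $L^*$ has the predicate symbols $=,\le$, constants $K_0,K_1,K_2$ for $0,1,2$, and the eight U-grounding function symbols: subtraction ($x-y=0$ if $x\le y$), division ($x\div y=\lfloor x/y\rfloor$, and $x\div 0=x$), $\mathrm{Root}(x,y)=\lceil x^{1/y}\rceil$ for $y\ge1$ and $\mathrm{Root}(x,0)=x$, maximum, $\mathrm{Logarithm}(x)=\lfloor\log_2x\rfloor$ for $x\ge2$ and $0$ otherwise, $\mathrm{Count}(x,j)$ = number of ones among the rightmost $j$ bits of $x$, addition, and $\mathrm{Double}(x)=x+x$ (no multiplication). A formula is $\Delta_0^*$ if all its quantifiers are bounded ($\forall v\le s$, $\exists v\le s$ with $s$ a term). $\Pi_1^*$ (resp. $\Sigma_1^*$) formulas are $\forall v_1\cdots\forall v_k\,\phi$ (resp. $\exists v_1\cdots\exists v_k\,\phi$), $k\ge0$, with $\phi$ in $\Delta_0^*$. **Deduction.** For a prenex sentence $\Phi$ let $\mathrm{Reverse}(\Phi)$ be $\neg\Phi$ with the negation moved inside the unbounded quantifier prefix. A semantic tableaux proof of $\Phi$ from a set $\alpha$ of sentences is a finite tree with root $\mathrm{Reverse}(\Phi)$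 in which every other node is an axiom of $\alpha$ or is deduced from an ancestor by one of the following rules, and every branch of which contains some formula together with its negation: $A\wedge B\Rightarrow A$ and $A\wedge B\Rightarrow B$; $\neg\neg A\Rightarrow A$; $\neg(A\vee B)\Rightarrow\neg A\wedge\neg B$; $\neg(A\to B)\Rightarrow A\wedge\neg B$; $\neg(A\wedge B)\Rightarrow\neg A\vee\neg B$; $\neg\exists v\,A\Rightarrow\forall v\,\neg A$ and $\neg\forall v\,A\Rightarrow\exists v\,\neg A$, also for bounded quantifiers; a pair of siblings $A,B$ below $A\vee B$, and a pair $\neg A,B$ below $A\to B$; $\exists v\,A(v)\Rightarrow A(u)$ and $\exists v\le s\,A(v)\Rightarrow u\le s\wedge A(u)$ with $u$ a new parameter symbol; $\forall v\,A(v)\Rightarrow A(t)$ and $\forall v\le s\,A(v)\Rightarrow t\le s\to A(t)$, where $t$ is built by the function symbols from constants and parameter symbols introduced at ancestors. (Equality has no rule of its own.) **The configuration $\xi^*$.** Its base axiom system $B^*$ is any set of $\Pi_1^*$ sentences that is consistent (there is no semantic tableaux proof of $0=1$ from it), proves every $\Delta_0^*$ sentence true in the standard model $\mathbb N$, and contains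 the axiom $\forall x\,\forall y\,\exists z\le x+y\;(z=x+y)$. Its deduction method is semantic tableaux. Proofs are encoded by natural numbers in any way such that the code of each semantic tableaux proof has at least $64$ bits, and has at least $5J$ bits if $J$ function symbols occur in the proof (counted with repetitions over all nodes, constants not counted). We do not distinguish a proof $p$ from its code, and $\mathrm{Log}$ is the base-2 logarithm. **Goodness.** For $N$ real or $\infty$, a $\Pi_1^*$ or $\Sigma_1^*$ sentence is $\mathrm{Good}(N)$ if it becomes true in $\mathbb N$ when its unbounded quantifiers $\forall v,\exists v$ are changed to $\forall v<2^N,\exists v<2^N$. For a set $\theta$ of $\Pi_1^*$ sentences let $\sharp(\theta)$ be the largest integer $J\ge0$ such that all sentences of $\theta$ are $\mathrm{Good}(J)$ ($\infty$ if all $J$ have this property, $-\infty$ if none has). **Theorem D.4.** For every such $B^*$ and every such encoding, the configuration $\xi^*$ is both A-stable and E-stable, hence EA-stable. That is, for every recursively enumerable set $\theta$ of $\Pi_1^*$ sentences (true or not): * (A-stability) if a $\Pi_1^*$ sentence $\Upsilon$ has a semantic tableaux proof $p$ from $\theta\cup B^*$ with $\mathrm{Log}(p)\le\sharp(\theta)+1$,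 then $\Upsilon$ is $\mathrm{Good}\big(\tfrac12\sharp(\theta)\big)$; * (E-stability) if a $\Sigma_1^*$ sentence $\Upsilon$ has a semantic tableaux proof $p$ from $\theta\cup B^*$ with $\mathrm{Log}(p)\le\sharp(\theta)+1$, then $\Upsilon$ is $\mathrm{Good}\big(\tfrac12\lfloor\mathrm{Log}(p)\rfloor-1\big)$. -/

import Mathlib

noncomputable section

namespace Willard

/-! ## Formulas, with bounded quantifiers as primitives -/

/-- Formulas over the function (and constant) symbols of `L`, with the two predicate symbols `=` and
`≤`, the connectives `¬ ∧ ∨ →`, unbounded quantifiers and bounded quantifiers `∀ v ≤ s`, `∃ v ≤ s`.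
Parameter symbols are taken from `P`; `n` is the number of free variables.  A quantifier binds the
last variable of its body (so the bound `s` cannot contain the quantified variable). -/
inductive Fml (L : FirstOrder.Language.{0, 0}) (P : Type) : ℕ → Type
  | eq {n : ℕ} (s t : L.Term (P ⊕ Fin n)) : Fml L P n
  | le {n : ℕ} (s t : L.Term (P ⊕ Fin n)) : Fml L P n
  | neg {n : ℕ} (A : Fml L P n) : Fml L P n
  | and {n : ℕ} (A B : Fml L P n) : Fml L P n
  | or {n : ℕ} (A B : Fml L P n) : Fml L P n
  | imp {n : ℕ} (A B : Fml L P n) : Fml L P n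
  | all {n : ℕ} (A : Fml L P (n + 1)) : Fml L P n
  | ex {n : ℕ} (A : Fml L P (n + 1)) : Fml L P n
  | ball {n : ℕ} (s : L.Term (P ⊕ Fin n)) (A : Fml L P (n + 1)) : Fml L P n
  | bex {n : ℕ} (s : L.Term (P ⊕ Fin n)) (A : Fml L P (n + 1)) : Fml L P n

/-- Sentences: no free variables and no parameter symbols. -/
abbrev Sentence (L : FirstOrder.Language.{0, 0}) : Type := Fml L Empty 0

/-- The formulas occurring in tableaux: no free variables, parameter symbols numbered by `ℕ`. -/
abbrev ParSentence (L : FirstOrder.Language.{0, 0}) : Type := Fml L ℕ 0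

section Formulas

variable {L : FirstOrder.Language.{0, 0}} {P Q : Type}

/-- The substitution `σ` carried under one quantifier. -/
def liftSubst {m n : ℕ} (σ : P ⊕ Fin m → L.Term (Q ⊕ Fin n)) :
    P ⊕ Fin (m + 1) → L.Term (Q ⊕ Fin (n + 1)) :=
  Sum.elim
    (fun p => (σ (Sum.inl p)).relabel (Sum.map id Fin.castSucc))
    (Fin.snoc (α := fun _ => L.Term (Q ⊕ Fin (n + 1)))
      (fun i => (σ (Sum.inr i)).relabel (Sum.map id Fin.castSucc))
      (FirstOrder.Language.Term.var (Sum.inr (Fin.last n))))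

/-- Simultaneous substitution of terms for parameters and free variables. -/
def Fml.subst : {m n : ℕ} → (P ⊕ Fin m → L.Term (Q ⊕ Fin n)) → Fml L P m → Fml L Q n
  | _, _, σ, .eq s t => .eq (s.subst σ) (t.subst σ)
  | _, _, σ, .le s t => .le (s.subst σ) (t.subst σ)
  | _, _, σ, .neg A => .neg (A.subst σ)
  | _, _, σ, .and A B => .and (A.subst σ) (B.subst σ)
  | _, _, σ, .or A B => .or (A.subst σ) (B.subst σ)
  | _, _, σ, .imp A B => .imp (A.subst σ) (B.subst σ)
  | _, _, σ, .all A => .all (A.subst (liftSubst σ))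
  | _, _, σ, .ex A => .ex (A.subst (liftSubst σ))
  | _, _, σ, .ball s A => .ball (s.subst σ) (A.subst (liftSubst σ))
  | _, _, σ, .bex s A => .bex (s.subst σ) (A.subst (liftSubst σ))

/-- `A(t)`: the closed term `t` is put for the only free variable of `A`. -/
def Fml.inst (A : Fml L P 1) (t : L.Term (P ⊕ Fin 0)) : Fml L P 0 :=
  A.subst (Sum.elim (fun p => FirstOrder.Language.Term.var (Sum.inl p)) (fun _ => t))

/-- A sentence, regarded as a formula in which parameter symbols are allowed. -/
def Fml.toPar (A : Sentence L) : ParSentence L :=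
  A.subst (Sum.elim Empty.elim Fin.elim0)

/-- Truth over the natural numbers, the unbounded quantifiers (and only these) being restricted to
range over `D`; `π` gives the values of the parameters and `x` those of the free variables. -/
def Fml.Holds [L.Structure ℕ] (D : Set ℕ) (π : P → ℕ) : {n : ℕ} → Fml L P n → (Fin n → ℕ) → Prop
  | _, .eq s t, x => s.realize (Sum.elim π x) = t.realize (Sum.elim π x)
  | _, .le s t, x => s.realize (Sum.elim π x) ≤ t.realize (Sum.elim π x)
  | _, .neg A, x => ¬ A.Holds D π x
  | _, .and A B, x => A.Holds D π x ∧ B.Holds D π x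
  | _, .or A B, x => A.Holds D π x ∨ B.Holds D π x
  | _, .imp A B, x => A.Holds D π x → B.Holds D π x
  | _, .all A, x => ∀ v ∈ D, A.Holds D π (Fin.snoc (α := fun _ => ℕ) x v)
  | _, .ex A, x => ∃ v ∈ D, A.Holds D π (Fin.snoc (α := fun _ => ℕ) x v)
  | _, .ball s A, x =>
      ∀ v ≤ s.realize (Sum.elim π x), A.Holds D π (Fin.snoc (α := fun _ => ℕ) x v)
  | _, .bex s A, x =>
      ∃ v ≤ s.realize (Sum.elim π x), A.Holds D π (Fin.snoc (α := fun _ => ℕ) x v)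

/-- Truth of a sentence in the standard model of the natural numbers. -/
def StdTrue [L.Structure ℕ] (A : Sentence L) : Prop :=
  A.Holds Set.univ Empty.elim Fin.elim0

/-- The value `2 ^ N`, for `N` real or infinite. -/
def E : EReal → EReal
  | ⊥ => 0
  | ⊤ => ⊤
  | (r : ℝ) => (((2 : ℝ) ^ r : ℝ) : EReal)

/-- `Good(N)`: the sentence becomes true in the standard model when each of its unbounded quantifiers
`∀ v`, `∃ v` is changed to `∀ v < 2 ^ N`, `∃ v < 2 ^ N`. -/
def Good [L.Structure ℕ] (N : EReal) (A : Sentence L) : Prop :=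
  A.Holds {v : ℕ | ((v : ℝ) : EReal) < E N} Empty.elim Fin.elim0

/-- `♯(θ)`: the largest integer `J ≥ 0` such that each sentence of `θ` is `Good(J)`.  It is `⊤` if
this is so for all `J`, and `⊥` if it is so for no `J`. -/
def sharp [L.Structure ℕ] (θ : Set (Sentence L)) : EReal :=
  sSup {x : EReal | ∃ J : ℕ, x = ((J : ℝ) : EReal) ∧ ∀ A ∈ θ, Good x A}

/-- The dual prenex form of `¬ A`: the leading unbounded quantifiers are dualized, and the remaining
part of the sentence is negated. -/
def Fml.reverse : {n : ℕ} → Fml L P n → Fml L P n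
  | _, .all A => .ex A.reverse
  | _, .ex A => .all A.reverse
  | _, A => .neg A

/-- Gödel numbers of formulas. -/
def Fml.gnum [Encodable P] [Encodable (Σ l, L.Functions l)] : {n : ℕ} → Fml L P n → ℕ
  | _, .eq s t => Nat.pair 0 (Nat.pair (Encodable.encode s) (Encodable.encode t))
  | _, .le s t => Nat.pair 1 (Nat.pair (Encodable.encode s) (Encodable.encode t))
  | _, .neg A => Nat.pair 2 A.gnum
  | _, .and A B => Nat.pair 3 (Nat.pair A.gnum B.gnum)
  | _, .or A B => Nat.pair 4 (Nat.pair A.gnum B.gnum)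
  | _, .imp A B => Nat.pair 5 (Nat.pair A.gnum B.gnum)
  | _, .all A => Nat.pair 6 A.gnum
  | _, .ex A => Nat.pair 7 A.gnum
  | _, .ball s A => Nat.pair 8 (Nat.pair (Encodable.encode s) A.gnum)
  | _, .bex s A => Nat.pair 9 (Nat.pair (Encodable.encode s) A.gnum)

theorem Fml.gnum_injective [Encodable P] [Encodable (Σ l, L.Functions l)] {n : ℕ} :
    Function.Injective (Fml.gnum : Fml L P n → ℕ) := by
  intro A
  induction A with
  | eq s t =>
    intro B h; cases B <;> simp [Fml.gnum, Nat.pair_eq_pair] at h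
    rw [h.1, h.2]
  | le s t =>
    intro B h; cases B <;> simp [Fml.gnum, Nat.pair_eq_pair] at h
    rw [h.1, h.2]
  | neg A ih =>
    intro B h; cases B <;> simp [Fml.gnum, Nat.pair_eq_pair] at h
    rw [ih h]
  | all A ih =>
    intro B h; cases B <;> simp [Fml.gnum, Nat.pair_eq_pair] at h
    rw [ih h]
  | ex A ih =>
    intro B h; cases B <;> simp [Fml.gnum, Nat.pair_eq_pair] at h
    rw [ih h]
  | and A A' ih ih' =>
    intro B h; cases B <;> simp [Fml.gnum, Nat.pair_eq_pair] at h
    rw [ih h.1, ih' h.2]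
  | or A A' ih ih' =>
    intro B h; cases B <;> simp [Fml.gnum, Nat.pair_eq_pair] at h
    rw [ih h.1, ih' h.2]
  | imp A A' ih ih' =>
    intro B h; cases B <;> simp [Fml.gnum, Nat.pair_eq_pair] at h
    rw [ih h.1, ih' h.2]
  | ball s A ih =>
    intro B h; cases B <;> simp [Fml.gnum, Nat.pair_eq_pair] at h
    rw [h.1, ih h.2]
  | bex s A ih =>
    intro B h; cases B <;> simp [Fml.gnum, Nat.pair_eq_pair] at h
    rw [h.1, ih h.2]

/-- A recursively enumerable set of sentences. -/
def IsRE [Encodable (Σ l, L.Functions l)] (θ : Set (Sentence L)) : Prop :=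
  REPred fun m : ℕ => ∃ A ∈ θ, A.gnum = m

end Formulas

/-! ## The classes `Π_k` and `Σ_k` over a class of bounded formulas -/

/-- A class of parameter-free formulas. -/
abbrev FmlClass (L : FirstOrder.Language.{0, 0}) : Type := ∀ n : ℕ, Set (Fml L Empty n)

/-- The formulas `∀ v₁ ⋯ ∀ v_k A` with `A` in `S`. -/
inductive AllBlock {L : FirstOrder.Language.{0, 0}} (S : FmlClass L) : ∀ n : ℕ, Fml L Empty n → Prop
  | base {n : ℕ} {A : Fml L Empty n} : A ∈ S n → AllBlock S n A
  | all {n : ℕ} {A : Fml L Empty (n + 1)} : AllBlock S (n + 1) A → AllBlock S n (.all A)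

/-- The formulas `∃ v₁ ⋯ ∃ v_k A` with `A` in `S`. -/
inductive ExBlock {L : FirstOrder.Language.{0, 0}} (S : FmlClass L) : ∀ n : ℕ, Fml L Empty n → Prop
  | base {n : ℕ} {A : Fml L Empty n} : A ∈ S n → ExBlock S n A
  | ex {n : ℕ} {A : Fml L Empty (n + 1)} : ExBlock S (n + 1) A → ExBlock S n (.ex A)

/-- The `k`-th level of the hierarchy over `Δ`: `Π_k` for `true`, `Σ_k` for `false`. -/
def hierarchy {L : FirstOrder.Language.{0, 0}} (Δ : FmlClass L) : Bool → ℕ → FmlClass L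
  | _, 0 => Δ
  | true, k + 1 => fun n => {A | AllBlock (hierarchy Δ false k) n A}
  | false, k + 1 => fun n => {A | ExBlock (hierarchy Δ true k) n A}

/-- `A` is a `Π_k` sentence over `Δ`. -/
def IsPi {L : FirstOrder.Language.{0, 0}} (Δ : FmlClass L) (k : ℕ) (A : Sentence L) : Prop :=
  A ∈ hierarchy Δ true k 0

/-- `A` is a `Σ_k` sentence over `Δ`. -/
def IsSigma {L : FirstOrder.Language.{0, 0}} (Δ : FmlClass L) (k : ℕ) (A : Sentence L) : Prop :=
  A ∈ hierarchy Δ false k 0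

/-- All quantifiers of the formula are bounded. -/
def Fml.FullyBounded {L : FirstOrder.Language.{0, 0}} {P : Type} : {n : ℕ} → Fml L P n → Prop
  | _, .eq _ _ => True
  | _, .le _ _ => True
  | _, .neg A => A.FullyBounded
  | _, .and A B => A.FullyBounded ∧ B.FullyBounded
  | _, .or A B => A.FullyBounded ∧ B.FullyBounded
  | _, .imp A B => A.FullyBounded ∧ B.FullyBounded
  | _, .all _ => False
  | _, .ex _ => False
  | _, .ball _ A => A.FullyBounded
  | _, .bex _ A => A.FullyBounded

/-! ## Configurations and their stability -/

/-- The 5-tuple of a configuration: a language (with its standard interpretation over `ℕ` and a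
numbering of its symbols), a class of `Δ₀` formulas, a base axiom system, a method of deduction
(`IsProof α A p`: `p` is a proof of `A` from the axiom system `α`) and a method for encoding proofs
as natural numbers. -/
structure Configuration where
  L : FirstOrder.Language.{0, 0}
  std : L.Structure ℕ
  symbolNumbering : Encodable (Σ l, L.Functions l)
  Delta0 : FmlClass L
  Base : Set (Sentence L)
  Proof : Type
  IsProof : Set (Sentence L) → Sentence L → Proof → Prop
  code : Proof → ℕ

attribute [instance] Configuration.std Configuration.symbolNumbering

namespace Configuration

variable (ξ : Configuration)

/-- The R-views: the recursively enumerable sets of `Π₁` sentences, whether true or not. -/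
def REClass : Set (Set (Sentence ξ.L)) :=
  {θ | (∀ A ∈ θ, IsPi ξ.Delta0 1 A) ∧ IsRE θ}

/-- The base-2 logarithm of the Gödel number of a proof. -/
def logCode (p : ξ.Proof) : ℝ := Real.logb 2 (ξ.code p)

/-- A-stability: for each R-view `θ`, each `Π₁` theorem of `θ ∪ B` having a proof `p` with
`Log p ≤ ♯(θ) + 1` is `Good(♯(θ) / 2)`. -/
def AStable : Prop :=
  ∀ θ ∈ ξ.REClass, ∀ A : Sentence ξ.L, IsPi ξ.Delta0 1 A →
    ∀ p : ξ.Proof, ξ.IsProof (θ ∪ ξ.Base) A p →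
      (ξ.logCode p : EReal) ≤ sharp θ + 1 → Good (sharp θ / 2) A

/-- E-stability: for each R-view `θ`, each `Σ₁` theorem of `θ ∪ B` having a proof `p` with
`Log p ≤ ♯(θ) + 1` is `Good(⌊Log p⌋ / 2 - 1)`. -/
def EStable : Prop :=
  ∀ θ ∈ ξ.REClass, ∀ A : Sentence ξ.L, IsSigma ξ.Delta0 1 A →
    ∀ p : ξ.Proof, ξ.IsProof (θ ∪ ξ.Base) A p →
      (ξ.logCode p : EReal) ≤ sharp θ + 1 →
        Good (((⌊ξ.logCode p⌋ : ℝ) / 2 - 1 : ℝ) : EReal) A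

/-- EA-stability: both E-stable and A-stable. -/
def EAStable : Prop := ξ.EStable ∧ ξ.AStable

end Configuration

/-! ## Semantic tableaux -/

section Tableaux

variable {L : FirstOrder.Language.{0, 0}}

/-- A finite tree below a root.  Each non-root node stores a formula; a node has no child, one child
or two children.  An only child is also labelled with the parameter symbol it introduces, if any. -/
inductive Tree (L : FirstOrder.Language.{0, 0}) : Type
  | leaf : Tree L
  | single (u : Option ℕ) (A : ParSentence L) (T : Tree L) : Tree L
  | pair (A : ParSentence L) (T : Tree L) (A' : ParSentence L) (T' : Tree L) : Tree L

/-- A tree together with the formula stored in its root. -/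
structure Tableau (L : FirstOrder.Language.{0, 0}) : Type where
  root : ParSentence L
  below : Tree L

/-- The parameter symbol `u`, as a term. -/
def parTerm (u : ℕ) : L.Term (ℕ ⊕ Fin 0) := FirstOrder.Language.Term.var (Sum.inl u)

/-- All parameter symbols in `t` belong to `U`. -/
def ParsIn (U : Set ℕ) (t : L.Term (ℕ ⊕ Fin 0)) : Prop :=
  ∀ u : ℕ, Sum.inl u ∈ t.varFinset → u ∈ U

/-- The non-branching rules.  `Rule U A u B`: on a branch that has so far introduced the parameter
symbols in `U`, the formula `B` is deduced from its ancestor `A`, introducing the new parameter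
symbol recorded by `u`, if any. -/
inductive Rule (U : Set ℕ) : ParSentence L → Option ℕ → ParSentence L → Prop
  | and_left (A B : ParSentence L) : Rule U (.and A B) none A
  | and_right (A B : ParSentence L) : Rule U (.and A B) none B
  | neg_neg (A : ParSentence L) : Rule U (.neg (.neg A)) none A
  | neg_or (A B : ParSentence L) : Rule U (.neg (.or A B)) none (.and (.neg A) (.neg B))
  | neg_imp (A B : ParSentence L) : Rule U (.neg (.imp A B)) none (.and A (.neg B))
  | neg_and (A B : ParSentence L) : Rule U (.neg (.and A B)) none (.or (.neg A) (.neg B))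
  | neg_ex (A : Fml L ℕ 1) : Rule U (.neg (.ex A)) none (.all (.neg A))
  | neg_all (A : Fml L ℕ 1) : Rule U (.neg (.all A)) none (.ex (.neg A))
  | neg_bex (s : L.Term (ℕ ⊕ Fin 0)) (A : Fml L ℕ 1) :
      Rule U (.neg (.bex s A)) none (.ball s (.neg A))
  | neg_ball (s : L.Term (ℕ ⊕ Fin 0)) (A : Fml L ℕ 1) :
      Rule U (.neg (.ball s A)) none (.bex s (.neg A))
  | ex (A : Fml L ℕ 1) (u : ℕ) (hu : u ∉ U) : Rule U (.ex A) (some u) (A.inst (parTerm u))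
  | bex (s : L.Term (ℕ ⊕ Fin 0)) (A : Fml L ℕ 1) (u : ℕ) (hu : u ∉ U) :
      Rule U (.bex s A) (some u) (.and (.le (parTerm u) s) (A.inst (parTerm u)))
  | all (A : Fml L ℕ 1) (t : L.Term (ℕ ⊕ Fin 0)) (ht : ParsIn U t) :
      Rule U (.all A) none (A.inst t)
  | ball (s : L.Term (ℕ ⊕ Fin 0)) (A : Fml L ℕ 1) (t : L.Term (ℕ ⊕ Fin 0)) (ht : ParsIn U t) :
      Rule U (.ball s A) none (.imp (.le t s) (A.inst t))

/-- The branching rules.  `BranchRule A B C`: the formulas `B` and `C` may be stored in a pair of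
sibling nodes with ancestor `A`. -/
inductive BranchRule : ParSentence L → ParSentence L → ParSentence L → Prop
  | or (A B : ParSentence L) : BranchRule (.or A B) A B
  | imp (A B : ParSentence L) : BranchRule (.imp A B) (.neg A) B

/-- Every node of the tree is an axiom of `α` or is deduced from a higher node; `Γ` is the set of the
formulas stored above the tree and `U` the set of the parameter symbols introduced above it. -/
def Tree.IsCandidate (α : Set (Sentence L)) :
    Set (ParSentence L) → Set ℕ → Tree L → Prop
  | _, _, .leaf => True
  | Γ, U, .single u A T =>
      ((u = none ∧ ∃ B ∈ α, A = B.toPar) ∨ ∃ B ∈ Γ, Rule U B u A) ∧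
        T.IsCandidate α (insert A Γ) {w | u = some w ∨ w ∈ U}
  | Γ, U, .pair A T A' T' =>
      (∃ B ∈ Γ, BranchRule B A A') ∧
        T.IsCandidate α (insert A Γ) U ∧ T'.IsCandidate α (insert A' Γ) U

/-- Every branch (including the formulas in `Γ`, which are stored above the tree) contains both some
formula and its negation. -/
def Tree.Closed : Set (ParSentence L) → Tree L → Prop
  | Γ, .leaf => ∃ A ∈ Γ, Fml.neg A ∈ Γ
  | Γ, .single _ A T => T.Closed (insert A Γ)
  | Γ, .pair A T A' T' => T.Closed (insert A Γ) ∧ T'.Closed (insert A' Γ)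

/-- `p` is a semantic tableaux proof of `A` from `α`: its root is the dual form of `¬ A`, its other
nodes are axioms or deduced from higher nodes, and all its branches are closed. -/
def IsTableauProof (α : Set (Sentence L)) (A : Sentence L) (p : Tableau L) : Prop :=
  p.root = A.reverse.toPar ∧ p.below.IsCandidate α {p.root} ∅ ∧ p.below.Closed {p.root}

/-- The number of occurrences of function symbols in a term; constant symbols do not count. -/
def termSymbols {X : Type} : L.Term X → ℕ
  | .var _ => 0
  | @FirstOrder.Language.Term.func _ _ l _ ts => (if l = 0 then 0 else 1) + ∑ i, termSymbols (ts i)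

/-- The number of occurrences of function symbols in a formula. -/
def Fml.symbols {P : Type} : {n : ℕ} → Fml L P n → ℕ
  | _, .eq s t => termSymbols s + termSymbols t
  | _, .le s t => termSymbols s + termSymbols t
  | _, .neg A => A.symbols
  | _, .and A B => A.symbols + B.symbols
  | _, .or A B => A.symbols + B.symbols
  | _, .imp A B => A.symbols + B.symbols
  | _, .all A => A.symbols
  | _, .ex A => A.symbols
  | _, .ball s A => termSymbols s + A.symbols
  | _, .bex s A => termSymbols s + A.symbols

/-- The number of occurrences of function symbols in a tree. -/
def Tree.symbols : Tree L → ℕ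
  | .leaf => 0
  | .single _ A T => A.symbols + T.symbols
  | .pair A T A' T' => A.symbols + T.symbols + (A'.symbols + T'.symbols)

/-- The number of occurrences of function symbols in a tableau. -/
def Tableau.symbols (p : Tableau L) : ℕ := p.root.symbols + p.below.symbols

/-- The requirement on an encoding of tableaux: the code of a semantic tableaux proof in which `J`
function symbols occur has at least `5 J` bits, and the code of any proof has at least 64 bits. -/
def ConventionalEncoding (g : Tableau L → ℕ) : Prop :=
  ∀ (α : Set (Sentence L)) (A : Sentence L) (p : Tableau L), IsTableauProof α A p →
    5 * p.symbols ≤ Nat.size (g p) ∧ 64 ≤ Nat.size (g p)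

end Tableaux

/-! ## The U-grounding language and the configuration `ξ*` -/

/-- The constant symbols for 0, 1, 2 and the eight U-grounding function symbols. -/
inductive USymbol : ℕ → Type
  | K0 : USymbol 0
  | K1 : USymbol 0
  | K2 : USymbol 0
  | logarithm : USymbol 1
  | double : USymbol 1
  | sub : USymbol 2
  | div : USymbol 2
  | root : USymbol 2
  | max : USymbol 2
  | count : USymbol 2
  | add : USymbol 2

/-- The language `L*` (whose predicate symbols `=` and `≤` are built into `Fml`). -/
abbrev ULang : FirstOrder.Language.{0, 0} where
  Functions := USymbol
  Relations := fun _ => Empty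

/-- The `y`-th root of `x`, rounded up; it is `x` for `y = 0`. -/
def uRoot (x y : ℕ) : ℕ := if y = 0 then x else ⌈(x : ℝ) ^ (1 / (y : ℝ))⌉₊

/-- Integer division; it is `x` for `y = 0`. -/
def uDiv (x y : ℕ) : ℕ := if y = 0 then x else x / y

/-- The number of ones among the rightmost `j` bits of `x`. -/
def uCount (x j : ℕ) : ℕ := ((Finset.range j).filter fun i => x.testBit i = true).card

/-- The values of the symbols. -/
def USymbol.value : {l : ℕ} → USymbol l → (Fin l → ℕ) → ℕ
  | _, .K0, _ => 0
  | _, .K1, _ => 1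
  | _, .K2, _ => 2
  | _, .logarithm, x => Nat.log 2 (x 0)
  | _, .double, x => x 0 + x 0
  | _, .sub, x => x 0 - x 1
  | _, .div, x => uDiv (x 0) (x 1)
  | _, .root, x => uRoot (x 0) (x 1)
  | _, .max, x => Max.max (x 0) (x 1)
  | _, .count, x => uCount (x 0) (x 1)
  | _, .add, x => x 0 + x 1

instance uStructure : ULang.Structure ℕ where
  funMap := fun f x => USymbol.value f x
  RelMap := fun r _ => r.elim

/-- A numbering of the symbols of `L*`. -/
def USymbol.number : {l : ℕ} → USymbol l → ℕ
  | _, .K0 => 0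
  | _, .K1 => 1
  | _, .K2 => 2
  | _, .logarithm => 3
  | _, .double => 4
  | _, .sub => 5
  | _, .div => 6
  | _, .root => 7
  | _, .max => 8
  | _, .count => 9
  | _, .add => 10

/-- The inverse of the numbering. -/
def USymbol.ofNumber : ℕ → Option (Σ l, ULang.Functions l)
  | 0 => some ⟨0, USymbol.K0⟩
  | 1 => some ⟨0, USymbol.K1⟩
  | 2 => some ⟨0, USymbol.K2⟩
  | 3 => some ⟨1, USymbol.logarithm⟩
  | 4 => some ⟨1, USymbol.double⟩
  | 5 => some ⟨2, USymbol.sub⟩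
  | 6 => some ⟨2, USymbol.div⟩
  | 7 => some ⟨2, USymbol.root⟩
  | 8 => some ⟨2, USymbol.max⟩
  | 9 => some ⟨2, USymbol.count⟩
  | 10 => some ⟨2, USymbol.add⟩
  | _ => none

instance uNumbering : Encodable (Σ l, ULang.Functions l) where
  encode := fun f => USymbol.number f.2
  decode := USymbol.ofNumber
  encodek := by rintro ⟨_, f⟩; cases f <;> rfl

/-- `Δ₀*`: the formulas of `L*` all of whose quantifiers are bounded. -/
def UDelta0 : FmlClass ULang := fun _ => {A | A.FullyBounded}

/-- The term `s + t`. -/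
def uAdd {X : Type} (s t : ULang.Term X) : ULang.Term X :=
  FirstOrder.Language.Term.func (USymbol.add : ULang.Functions 2) ![s, t]

/-- The sentence `∀ x ∀ y ∃ z ≤ x + y, z = x + y`: addition is a total function. -/
def addTotal : Sentence ULang :=
  .all (.all (.bex
    (uAdd (FirstOrder.Language.Term.var (Sum.inr 0)) (FirstOrder.Language.Term.var (Sum.inr 1)))
    (.eq (FirstOrder.Language.Term.var (Sum.inr 2))
      (uAdd (FirstOrder.Language.Term.var (Sum.inr 0)) (FirstOrder.Language.Term.var (Sum.inr 1))))))

/-- The sentence `0 = 1`. -/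
def zeroEqOne : Sentence ULang :=
  .eq (FirstOrder.Language.Term.func (USymbol.K0 : ULang.Functions 0) ![])
    (FirstOrder.Language.Term.func (USymbol.K1 : ULang.Functions 0) ![])

/-- The base axiom systems allowed for `ξ*`: consistent sets of `Π₁*` sentences that prove (by
semantic tableaux) each `Δ₀*` sentence which is true in the standard model, and which contain the
sentence asserting the totality of addition. -/
structure IsBaseSystem (B : Set (Sentence ULang)) : Prop where
  consistent : ¬ ∃ p, IsTableauProof B zeroEqOne p
  pi_one : ∀ A ∈ B, IsPi UDelta0 1 A
  delta_zero_complete : ∀ A : Sentence ULang, A.FullyBounded → StdTrue A →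
    ∃ p, IsTableauProof B A p
  add_total : addTotal ∈ B

/-- The configuration `ξ*` with base axiom system `B` and encoding `g` of tableaux. -/
def xiStar (B : Set (Sentence ULang)) (g : Tableau ULang → ℕ) : Configuration where
  L := ULang
  std := uStructure
  symbolNumbering := uNumbering
  Delta0 := UDelta0
  Base := B
  Proof := Tableau ULang
  IsProof := IsTableauProof
  code := g

end Willard

end

/-! The proof is soundness of tableaux with a bound on growth. If the asserted goodness of a
sentence fails, its reversed form is true with the quantifiers cut off at the corresponding bound.
Walk down the tableau from the root, giving each new parameter symbol a natural number and choosing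
a true sibling at each branching. If every formula met stays true, the branch never contains a
formula and its negation, so the tableau is not closed.

The difficulty is that the axioms of `θ` are only known to hold below `2 ^ ♯(θ)`, so universal
formulas may be instantiated only at values in an initial segment `D`. Each function symbol at most
doubles a bound `≥ 2` on its arguments; hence a node with `k` function symbols raises the bound `V`
on the parameters to at most `V * 2 ^ k`, and a whole branch costs at most the number of symbols in
the tableau, which is at most a fifth of the bit length of its code. This is carried by
`Rule.admissible`, `Tree.not_closed_of_admissible` and `IsTableauProof.not_reverse`. For A-stability
the reversed theorem is existential, the starting bound is about `2 ^ (♯(θ) / 2)`, and the other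
half of the exponent pays for the terms. For E-stability it is universal, the starting bound is `2`,
and `D` can be cut at `2 ^ (⌊Log p⌋ / 2 - 1)`.

The axioms of `B` have to be true as well. By `IsBaseSystem.stdTrue`, a false one would have a false
closed instance whose negation `B` proves, and the two combine to a proof of `0 = 1`. -/

namespace Willard

open FirstOrder FirstOrder.Language

/-! ### Substitution, prenex shapes and occurrence of parameters -/

section Substitution

variable {L : FirstOrder.Language.{0, 0}} {P Q R : Type}

theorem subst_relabel {X Y Z : Type} (f : X → Y) (τ : Y → L.Term Z) (t : L.Term X) :
    (t.relabel f).subst τ = t.subst (τ ∘ f) := by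
  induction t with
  | var => rfl
  | func g ts ih => simp [Term.relabel, Term.subst, ih]

theorem relabel_subst {X Y Z : Type} (σ : X → L.Term Y) (f : Y → Z) (t : L.Term X) :
    (t.subst σ).relabel f = t.subst fun x => (σ x).relabel f := by
  induction t with
  | var => rfl
  | func g ts ih => simp [Term.relabel, Term.subst, ih]

theorem subst_subst {X Y Z : Type} (σ : X → L.Term Y) (τ : Y → L.Term Z) (t : L.Term X) :
    (t.subst σ).subst τ = t.subst fun x => (σ x).subst τ := by
  induction t with
  | var => rfl
  | func g ts ih => simp [Term.subst, ih]

theorem relabel_castSucc_subst_liftSubst {n k : ℕ} (τ : Q ⊕ Fin n → L.Term (R ⊕ Fin k))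
    (t : L.Term (Q ⊕ Fin n)) :
    (t.relabel (Sum.map id Fin.castSucc)).subst (liftSubst τ) =
      (t.subst τ).relabel (Sum.map id Fin.castSucc) := by
  rw [subst_relabel, relabel_subst]
  congr 1
  funext z
  rcases z with q | i <;> simp [liftSubst]

theorem liftSubst_comp {m n k : ℕ} (σ : P ⊕ Fin m → L.Term (Q ⊕ Fin n))
    (τ : Q ⊕ Fin n → L.Term (R ⊕ Fin k)) :
    (fun z => (liftSubst σ z).subst (liftSubst τ)) = liftSubst fun z => (σ z).subst τ := by
  funext z
  rcases z with p | i
  · simp [liftSubst, ← relabel_castSucc_subst_liftSubst]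
  · refine Fin.lastCases ?_ (fun i => ?_) i
    · simp [liftSubst, Term.subst]
    · simp [liftSubst, ← relabel_castSucc_subst_liftSubst]

theorem Fml.subst_subst {m n k : ℕ} (A : Fml L P m) (σ : P ⊕ Fin m → L.Term (Q ⊕ Fin n))
    (τ : Q ⊕ Fin n → L.Term (R ⊕ Fin k)) :
    (A.subst σ).subst τ = A.subst fun z => (σ z).subst τ := by
  induction A generalizing n k <;>
    simp_all [Fml.subst, Willard.subst_subst, liftSubst_comp]

theorem Fml.FullyBounded.subst {m n : ℕ} {A : Fml L P m} (hA : A.FullyBounded)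
    (σ : P ⊕ Fin m → L.Term (Q ⊕ Fin n)) : (A.subst σ).FullyBounded := by
  induction A generalizing n <;> simp_all [Fml.subst, Fml.FullyBounded]

/-- A block of unbounded universal quantifiers followed by a formula with bounded quantifiers. -/
def Fml.IsUniversal : {n : ℕ} → Fml L P n → Prop
  | _, .all A => A.IsUniversal
  | _, A => A.FullyBounded

/-- A block of unbounded existential quantifiers followed by a formula with bounded quantifiers. -/
def Fml.IsExistential : {n : ℕ} → Fml L P n → Prop
  | _, .ex A => A.IsExistential
  | _, A => A.FullyBounded

theorem Fml.FullyBounded.isUniversal {n : ℕ} {A : Fml L P n} (hA : A.FullyBounded) :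
    A.IsUniversal := by
  cases A <;> first | exact hA | exact hA.elim

theorem Fml.FullyBounded.isExistential {n : ℕ} {A : Fml L P n} (hA : A.FullyBounded) :
    A.IsExistential := by
  cases A <;> first | exact hA | exact hA.elim

theorem Fml.IsUniversal.subst {m n : ℕ} {A : Fml L P m} (hA : A.IsUniversal)
    (σ : P ⊕ Fin m → L.Term (Q ⊕ Fin n)) : (A.subst σ).IsUniversal := by
  induction A generalizing n with
  | all A ih => exact ih hA _
  | _ => exact (Fml.FullyBounded.subst hA σ).isUniversal

theorem Fml.IsExistential.subst {m n : ℕ} {A : Fml L P m} (hA : A.IsExistential)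
    (σ : P ⊕ Fin m → L.Term (Q ⊕ Fin n)) : (A.subst σ).IsExistential := by
  induction A generalizing n with
  | ex A ih => exact ih hA _
  | _ => exact (Fml.FullyBounded.subst hA σ).isExistential

theorem Fml.FullyBounded.reverse {n : ℕ} {A : Fml L P n} (hA : A.FullyBounded) :
    A.reverse = .neg A := by
  cases A <;> first | rfl | exact hA.elim

theorem Fml.IsUniversal.reverse {n : ℕ} {A : Fml L P n} (hA : A.IsUniversal) :
    A.reverse.IsExistential := by
  induction A with
  | all A ih => exact ih hA
  | ex A ih => exact hA.elim
  | _ => exact hA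

theorem Fml.IsExistential.reverse {n : ℕ} {A : Fml L P n} (hA : A.IsExistential) :
    A.reverse.IsUniversal := by
  induction A with
  | all A ih => exact hA.elim
  | ex A ih => exact ih hA
  | _ => exact hA

/-- All parameter symbols of the term belong to `U`. -/
def TermOver {n : ℕ} (U : Set P) : L.Term (P ⊕ Fin n) → Prop
  | .var (.inl p) => p ∈ U
  | .var (.inr _) => True
  | .func _ ts => ∀ i, TermOver U (ts i)

/-- All parameter symbols of the formula belong to `U`. -/
def Fml.Over (U : Set P) : {n : ℕ} → Fml L P n → Prop
  | _, .eq s t => TermOver U s ∧ TermOver U t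
  | _, .le s t => TermOver U s ∧ TermOver U t
  | _, .neg A => A.Over U
  | _, .and A B => A.Over U ∧ B.Over U
  | _, .or A B => A.Over U ∧ B.Over U
  | _, .imp A B => A.Over U ∧ B.Over U
  | _, .all A => A.Over U
  | _, .ex A => A.Over U
  | _, .ball s A => TermOver U s ∧ A.Over U
  | _, .bex s A => TermOver U s ∧ A.Over U

theorem TermOver.mono {n : ℕ} {U V : Set P} (h : U ⊆ V) {t : L.Term (P ⊕ Fin n)}
    (ht : TermOver U t) : TermOver V t := by
  induction t with
  | var z => rcases z with p | i; exacts [h ht, trivial]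
  | func f ts ih => exact fun i => ih i (ht i)

theorem Fml.Over.mono {n : ℕ} {U V : Set P} (h : U ⊆ V) {A : Fml L P n} (hA : A.Over U) :
    A.Over V := by
  induction A with
  | eq | le => exact ⟨hA.1.mono h, hA.2.mono h⟩
  | neg _ ih | all _ ih | ex _ ih => exact ih hA
  | and _ _ ih ih' | or _ _ ih ih' | imp _ _ ih ih' => exact ⟨ih hA.1, ih' hA.2⟩
  | ball _ _ ih | bex _ _ ih => exact ⟨hA.1.mono h, ih hA.2⟩

theorem TermOver.relabel {m n : ℕ} {U : Set P} (f : Fin m → Fin n) {t : L.Term (P ⊕ Fin m)}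
    (ht : TermOver U t) : TermOver U (t.relabel (Sum.map id f)) := by
  induction t with
  | var z => rcases z with p | i; exacts [ht, trivial]
  | func g ts ih => exact fun i => ih i (ht i)

theorem TermOver.subst {m n : ℕ} {U : Set P} {V : Set Q} {σ : P ⊕ Fin m → L.Term (Q ⊕ Fin n)}
    (hp : ∀ p ∈ U, TermOver V (σ (.inl p))) (hi : ∀ i, TermOver V (σ (.inr i)))
    {t : L.Term (P ⊕ Fin m)} (ht : TermOver U t) : TermOver V (t.subst σ) := by
  induction t with
  | var z => rcases z with p | i; exacts [hp p ht, hi i]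
  | func g ts ih => exact fun i => ih i (ht i)

theorem Fml.Over.subst {m n : ℕ} {U : Set P} {V : Set Q} {σ : P ⊕ Fin m → L.Term (Q ⊕ Fin n)}
    (hp : ∀ p ∈ U, TermOver V (σ (.inl p))) (hi : ∀ i, TermOver V (σ (.inr i)))
    {A : Fml L P m} (hA : A.Over U) : (A.subst σ).Over V := by
  have key : ∀ {m n : ℕ} {σ : P ⊕ Fin m → L.Term (Q ⊕ Fin n)},
      (∀ p ∈ U, TermOver V (σ (.inl p))) → (∀ i, TermOver V (σ (.inr i))) →
      (∀ p ∈ U, TermOver V (liftSubst σ (.inl p))) ∧ ∀ i, TermOver V (liftSubst σ (.inr i)) := by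
    intro m n σ hp hi
    refine ⟨fun p h => (hp p h).relabel _, fun i => Fin.lastCases ?_ (fun i => ?_) i⟩
    · simp [liftSubst, TermOver]
    · simpa [liftSubst] using (hi i).relabel _
  induction A generalizing n with
  | eq | le => exact ⟨hA.1.subst hp hi, hA.2.subst hp hi⟩
  | neg _ ih => exact ih hp hi hA
  | all _ ih | ex _ ih => exact ih (key hp hi).1 (key hp hi).2 hA
  | and _ _ ih ih' | or _ _ ih ih' | imp _ _ ih ih' => exact ⟨ih hp hi hA.1, ih' hp hi hA.2⟩
  | ball _ _ ih | bex _ _ ih =>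
    exact ⟨hA.1.subst hp hi, ih (key hp hi).1 (key hp hi).2 hA.2⟩

theorem Fml.Over.inst {U : Set P} {A : Fml L P 1} (hA : A.Over U) {t : L.Term (P ⊕ Fin 0)}
    (ht : TermOver U t) : (A.inst t).Over U :=
  hA.subst (fun _ hp => hp) fun _ => ht

theorem Fml.over_toPar (A : Sentence L) (U : Set ℕ) : A.toPar.Over U := by
  have hT : ∀ {n : ℕ} (t : L.Term (Empty ⊕ Fin n)), TermOver Set.univ t := fun t => by
    induction t with
    | var z => rcases z with p | i; exacts [p.elim, trivial]
    | func g ts ih => exact fun i => ih i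
  have hF : ∀ {n : ℕ} (A : Fml L Empty n), A.Over Set.univ := fun A => by
    induction A <;> simp_all [Fml.Over]
  exact (hF A).subst (fun p => p.elim) fun i => i.elim0

theorem ParsIn.termOver {U : Set ℕ} {t : L.Term (ℕ ⊕ Fin 0)} (ht : ParsIn U t) : TermOver U t := by
  induction t with
  | var z =>
    rcases z with p | i
    · exact ht p (by simp [Term.varFinset])
    · trivial
  | func g ts ih =>
    refine fun i => ih i fun u hu => ht u ?_
    simp only [Term.varFinset, Finset.mem_biUnion, Finset.mem_univ, true_and]
    exact ⟨i, hu⟩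

theorem termSymbols_relabel {X Y : Type} (f : X → Y) (t : L.Term X) :
    termSymbols (t.relabel f) = termSymbols t := by
  induction t with
  | var => rfl
  | func g ts ih => simp [Term.relabel, termSymbols, ih]

end Substitution

/-! ### Truth under substitution, change of valuation and change of range -/

section Semantics

variable {L : FirstOrder.Language.{0, 0}} [L.Structure ℕ] {P Q : Type}

theorem realize_relabel_castSucc {n : ℕ} (π : P → ℕ) (x : Fin n → ℕ) (v : ℕ)
    (t : L.Term (P ⊕ Fin n)) :
    (t.relabel (Sum.map id Fin.castSucc)).realize
        (Sum.elim π (Fin.snoc (α := fun _ => ℕ) x v)) = t.realize (Sum.elim π x) := by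
  rw [Term.realize_relabel]
  congr 1
  funext z
  rcases z with p | i <;> simp

theorem realize_subst_elim {m n : ℕ} (σ : P ⊕ Fin m → L.Term (Q ⊕ Fin n)) (π : Q → ℕ)
    (x : Fin n → ℕ) (t : L.Term (P ⊕ Fin m)) :
    (t.subst σ).realize (Sum.elim π x) =
      t.realize (Sum.elim (fun p => (σ (.inl p)).realize (Sum.elim π x))
        fun i => (σ (.inr i)).realize (Sum.elim π x)) := by
  rw [Term.realize_subst]
  congr 1
  funext z
  rcases z with p | i <;> rfl

theorem Fml.holds_subst {m n : ℕ} (D : Set ℕ) (A : Fml L P m)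
    (σ : P ⊕ Fin m → L.Term (Q ⊕ Fin n)) (π : Q → ℕ) (x : Fin n → ℕ) :
    (A.subst σ).Holds D π x ↔
      A.Holds D (fun p => (σ (.inl p)).realize (Sum.elim π x))
        fun i => (σ (.inr i)).realize (Sum.elim π x) := by
  have hp : ∀ {m n : ℕ} (σ : P ⊕ Fin m → L.Term (Q ⊕ Fin n)) (x : Fin n → ℕ) (v : ℕ),
      (fun p => (liftSubst σ (.inl p)).realize
        (Sum.elim π (Fin.snoc (α := fun _ => ℕ) x v))) =
        fun p => (σ (.inl p)).realize (Sum.elim π x) := fun σ x v => by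
    funext p; exact realize_relabel_castSucc π x v _
  have hi : ∀ {m n : ℕ} (σ : P ⊕ Fin m → L.Term (Q ⊕ Fin n)) (x : Fin n → ℕ) (v : ℕ),
      (fun i => (liftSubst σ (.inr i)).realize
        (Sum.elim π (Fin.snoc (α := fun _ => ℕ) x v))) =
        Fin.snoc (α := fun _ => ℕ) (fun i => (σ (.inr i)).realize (Sum.elim π x)) v :=
    fun σ x v => by
      funext i
      refine Fin.lastCases ?_ (fun i => ?_) i
      · simp [liftSubst]
      · simpa [liftSubst] using realize_relabel_castSucc π x v _
  induction A generalizing n with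
  | eq | le => simp only [Fml.subst, Fml.Holds, realize_subst_elim]
  | neg _ ih => simp only [Fml.subst, Fml.Holds, ih]
  | and _ _ ih ih' | or _ _ ih ih' | imp _ _ ih ih' => simp only [Fml.subst, Fml.Holds, ih, ih']
  | all _ ih | ex _ ih => simp only [Fml.subst, Fml.Holds, ih, hp, hi]
  | ball _ _ ih | bex _ _ ih =>
    simp only [Fml.subst, Fml.Holds, ih, hp, hi, realize_subst_elim]

theorem Fml.holds_inst (D : Set ℕ) (A : Fml L P 1) (t : L.Term (P ⊕ Fin 0)) (π : P → ℕ)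
    (x : Fin 0 → ℕ) :
    (A.inst t).Holds D π x ↔
      A.Holds D π (Fin.snoc (α := fun _ => ℕ) x (t.realize (Sum.elim π x))) := by
  rw [Fml.inst, Fml.holds_subst]
  have : (fun _ : Fin 1 => t.realize (Sum.elim π x)) =
      Fin.snoc (α := fun _ => ℕ) x (t.realize (Sum.elim π x)) := by
    funext i
    rw [Subsingleton.elim i (Fin.last 0), Fin.snoc_last]
  exact iff_of_eq (congrArg (A.Holds D π) this)

theorem Fml.holds_toPar (D : Set ℕ) (A : Sentence L) (π : ℕ → ℕ) (x : Fin 0 → ℕ) :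
    A.toPar.Holds D π x ↔ A.Holds D Empty.elim Fin.elim0 := by
  rw [Fml.toPar, Fml.holds_subst]
  exact iff_of_eq (congrArg₂ (fun ρ y => A.Holds D ρ y) (funext fun p : Empty => p.elim)
    (funext fun i : Fin 0 => i.elim0))

theorem TermOver.realize_congr {n : ℕ} {U : Set P} {π π' : P → ℕ} (h : Set.EqOn π π' U)
    (x : Fin n → ℕ) {t : L.Term (P ⊕ Fin n)} (ht : TermOver U t) :
    t.realize (Sum.elim π x) = t.realize (Sum.elim π' x) := by
  induction t with
  | var z => rcases z with p | i; exacts [h ht, rfl]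
  | func g ts ih => simp only [Term.realize_func]; congr 1; funext i; exact ih i (ht i)

/-- This is what lets a fresh parameter receive a value without disturbing the formulas already on
the branch. -/
theorem Fml.Over.holds_congr {n : ℕ} {U : Set P} {π π' : P → ℕ} (h : Set.EqOn π π' U) (D : Set ℕ)
    {A : Fml L P n} (hA : A.Over U) (x : Fin n → ℕ) : A.Holds D π x ↔ A.Holds D π' x := by
  induction A with
  | eq | le => simp only [Fml.Holds, hA.1.realize_congr h, hA.2.realize_congr h]
  | neg _ ih => simp only [Fml.Holds, ih hA]
  | and _ _ ih ih' | or _ _ ih ih' | imp _ _ ih ih' => simp only [Fml.Holds, ih hA.1, ih' hA.2]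
  | all _ ih | ex _ ih => simp only [Fml.Holds, ih hA]
  | ball _ _ ih | bex _ _ ih => simp only [Fml.Holds, ih hA.2, hA.1.realize_congr h]

theorem Fml.FullyBounded.holds_congr {n : ℕ} {A : Fml L P n} (hA : A.FullyBounded) (D D' : Set ℕ)
    (π : P → ℕ) (x : Fin n → ℕ) : A.Holds D π x ↔ A.Holds D' π x := by
  induction A with
  | eq | le => rfl
  | neg _ ih => simp only [Fml.Holds, ih hA]
  | and _ _ ih ih' | or _ _ ih ih' | imp _ _ ih ih' => simp only [Fml.Holds, ih hA.1, ih' hA.2]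
  | all _ ih | ex _ ih => exact hA.elim
  | ball _ _ ih | bex _ _ ih => simp only [Fml.Holds, ih hA]

theorem Fml.IsUniversal.holds_anti {n : ℕ} {A : Fml L P n} (hA : A.IsUniversal) {D D' : Set ℕ}
    (hD : D ⊆ D') {π : P → ℕ} {x : Fin n → ℕ} (h : A.Holds D' π x) : A.Holds D π x := by
  induction A with
  | all A ih => exact fun v hv => ih hA (h v (hD hv))
  | _ => exact (Fml.FullyBounded.holds_congr hA D D' π x).2 h

theorem Fml.IsExistential.holds_mono {n : ℕ} {A : Fml L P n} (hA : A.IsExistential)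
    {D D' : Set ℕ} (hD : D ⊆ D') {π : P → ℕ} {x : Fin n → ℕ} (h : A.Holds D π x) :
    A.Holds D' π x := by
  induction A with
  | ex A ih => obtain ⟨v, hv, h⟩ := h; exact ⟨v, hD hv, ih hA h⟩
  | _ => exact (Fml.FullyBounded.holds_congr hA D D' π x).1 h

theorem Fml.holds_reverse {n : ℕ} (A : Fml L P n) (D : Set ℕ) (π : P → ℕ) (x : Fin n → ℕ) :
    A.reverse.Holds D π x ↔ ¬ A.Holds D π x := by
  induction A <;> simp_all [Fml.reverse, Fml.Holds]

/-- A universal formula that holds on every set of a directed exhaustion of `ℕ` holds on `ℕ`. -/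
theorem Fml.IsUniversal.holds_univ {n : ℕ} {A : Fml L P n} (hA : A.IsUniversal) {π : P → ℕ}
    {x : Fin n → ℕ} (h : ∀ k : ℕ, A.Holds {v | v < k} π x) : A.Holds Set.univ π x := by
  suffices H : ∀ k₀ : ℕ, (∀ k ≥ k₀, A.Holds {v | v < k} π x) → A.Holds Set.univ π x from
    H 0 fun k _ => h k
  clear h
  intro k₀ h
  induction A generalizing k₀ with
  | all A ih =>
    exact fun v _ => ih hA (max k₀ (v + 1)) fun k hk =>
      h k ((le_max_left _ _).trans hk) v ((le_max_right _ _).trans hk)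
  | _ => exact (Fml.FullyBounded.holds_congr hA _ _ π x).1 (h k₀ le_rfl)

/-- Either the term put for a variable occurs in the result of the substitution, or the value of
the term does not depend on this variable. -/
theorem termSymbols_le_or_realize_eq {m n : ℕ} (σ : P ⊕ Fin m → L.Term (Q ⊕ Fin n)) (i : Fin m)
    (t : L.Term (P ⊕ Fin m)) :
    termSymbols (σ (.inr i)) ≤ termSymbols (t.subst σ) ∨
      ∀ (π : P → ℕ) (x x' : Fin m → ℕ), (∀ j ≠ i, x j = x' j) →
        t.realize (Sum.elim π x) = t.realize (Sum.elim π x') := by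
  induction t with
  | var z =>
    rcases z with p | j
    · exact .inr fun _ _ _ _ => rfl
    · by_cases hj : j = i
      · subst hj; exact .inl le_rfl
      · exact .inr fun π x x' h => h j hj
  | func g ts ih =>
    by_cases H : ∃ k, termSymbols (σ (.inr i)) ≤ termSymbols ((ts k).subst σ)
    · obtain ⟨k, hk⟩ := H
      refine .inl (hk.trans ?_)
      simp only [Term.subst, termSymbols]
      exact (Finset.single_le_sum (f := fun k => termSymbols ((ts k).subst σ))
        (fun _ _ => Nat.zero_le _) (Finset.mem_univ k)).trans (Nat.le_add_left _ _)
    · refine .inr fun π x x' h => ?_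
      simp only [Term.realize_func]
      congr 1
      funext k
      exact (ih k).resolve_left (fun hk => H ⟨k, hk⟩) π x x' h

/-- A variable that occurs in the formula leaves a full copy of its term after substitution; a
variable that does not occur cannot influence truth. -/
theorem Fml.symbols_le_or_holds_iff {m n : ℕ} (σ : P ⊕ Fin m → L.Term (Q ⊕ Fin n)) (i : Fin m)
    (A : Fml L P m) :
    termSymbols (σ (.inr i)) ≤ (A.subst σ).symbols ∨
      ∀ (D : Set ℕ) (π : P → ℕ) (x x' : Fin m → ℕ), (∀ j ≠ i, x j = x' j) →
        (A.Holds D π x ↔ A.Holds D π x') := by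
  have hl : ∀ {m n : ℕ} (σ : P ⊕ Fin m → L.Term (Q ⊕ Fin n)) (i : Fin m),
      termSymbols (liftSubst σ (.inr i.castSucc)) = termSymbols (σ (.inr i)) := fun σ i => by
    simp [liftSubst, termSymbols_relabel]
  have hs : ∀ {m : ℕ} {i : Fin m} {x x' : Fin m → ℕ} (v : ℕ), (∀ j ≠ i, x j = x' j) →
      ∀ j ≠ i.castSucc, Fin.snoc (α := fun _ => ℕ) x v j = Fin.snoc (α := fun _ => ℕ) x' v j := by
    intro m i x x' v h j
    refine Fin.lastCases (fun _ => by simp) (fun j hj => ?_) j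
    simpa using h j fun e => hj (by rw [e])
  induction A generalizing n with
  | eq s t | le s t =>
    rcases termSymbols_le_or_realize_eq σ i s with h | h
    · exact .inl (h.trans (Nat.le_add_right _ _))
    rcases termSymbols_le_or_realize_eq σ i t with h' | h'
    · exact .inl (h'.trans (Nat.le_add_left _ _))
    refine .inr fun D π x x' hx => ?_
    simp only [Fml.Holds, h π x x' hx, h' π x x' hx]
  | neg A ih =>
    rcases ih σ i with h | h
    · exact .inl h
    · exact .inr fun D π x x' hx => not_congr (h D π x x' hx)
  | and A B ih ih' | or A B ih ih' | imp A B ih ih' =>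
    rcases ih σ i with h | h
    · exact .inl (h.trans (Nat.le_add_right _ _))
    rcases ih' σ i with h' | h'
    · exact .inl (h'.trans (Nat.le_add_left _ _))
    refine .inr fun D π x x' hx => ?_
    simp only [Fml.Holds, h D π x x' hx, h' D π x x' hx]
  | all A ih | ex A ih =>
    rcases ih (liftSubst σ) i.castSucc with h | h
    · exact .inl ((hl σ i).ge.trans h)
    refine .inr fun D π x x' hx => ?_
    simp only [Fml.Holds, fun v => h D π _ _ (hs v hx)]
  | ball s A ih | bex s A ih =>
    rcases termSymbols_le_or_realize_eq σ i s with h' | h'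
    · exact .inl (h'.trans (Nat.le_add_right _ _))
    rcases ih (liftSubst σ) i.castSucc with h | h
    · exact .inl (((hl σ i).ge.trans h).trans (Nat.le_add_left _ _))
    refine .inr fun D π x x' hx => ?_
    simp only [Fml.Holds, fun v => h D π _ _ (hs v hx), h' π x x' hx]

/-- The symbol count of a tableau sees only terms that survive in its nodes. Under a vacuous
quantifier a huge term may be instantiated without being counted; the second alternative makes its
value harmless. -/
theorem Fml.symbols_le_or_holds_inst (A : Fml L P 1) (t : L.Term (P ⊕ Fin 0)) (π : P → ℕ) :
    termSymbols t ≤ (A.inst t).symbols ∨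
      ∀ (D : Set ℕ) (x x' : Fin 1 → ℕ), A.Holds D π x → A.Holds D π x' := by
  rcases A.symbols_le_or_holds_iff
    (Sum.elim (fun p => Term.var (Sum.inl p)) fun _ => t) 0 with h | h
  · exact .inl h
  · exact .inr fun D x x' hx => (h D π x x' fun j hj => (hj (Subsingleton.elim _ _)).elim).1 hx

end Semantics

/-! ### Growth rate of the U-grounding functions -/

section Growth

theorem uDiv_le (x y : ℕ) : uDiv x y ≤ x := by
  unfold uDiv
  split
  · exact le_rfl
  · exact Nat.div_le_self x y

theorem uRoot_le (x y : ℕ) : uRoot x y ≤ x := by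
  unfold uRoot
  split
  · exact le_rfl
  · rename_i hy
    rw [Nat.ceil_le]
    rcases Nat.eq_zero_or_pos x with rfl | hx
    · simp [Real.zero_rpow, hy]
    · have hx' : (1 : ℝ) ≤ x := by exact_mod_cast hx
      have hy' : (1 : ℝ) ≤ y := by exact_mod_cast Nat.one_le_iff_ne_zero.2 hy
      calc (x : ℝ) ^ (1 / (y : ℝ)) ≤ (x : ℝ) ^ (1 : ℝ) :=
            Real.rpow_le_rpow_of_exponent_le hx' (by rw [one_div]; exact inv_le_one_of_one_le₀ hy')
        _ = x := Real.rpow_one _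

theorem uCount_le (x j : ℕ) : uCount x j ≤ x := by
  unfold uCount
  calc _ ≤ (Finset.range x).card := Finset.card_le_card fun i hi => by
        -- A one in position `i` forces `2 ^ i ≤ x`, hence `i < x`.
        rw [Finset.mem_filter] at hi
        exact Finset.mem_range.2 (Nat.lt_two_pow_self.trans_le (Nat.ge_two_pow_of_testBit hi.2))
    _ = x := Finset.card_range x

/-- The constants are at most `2`, and each function symbol at most doubles a bound on its
arguments. -/
theorem USymbol.value_le {l : ℕ} (f : USymbol l) (x : Fin l → ℕ) {M : ℕ} (hM : 2 ≤ M)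
    (hx : ∀ i, x i ≤ M) : f.value x ≤ M * 2 ^ (if l = 0 then 0 else 1) := by
  cases f <;> simp only [USymbol.value] <;> norm_num
  · omega
  · omega
  · exact (Nat.log_le_self 2 _).trans ((hx 0).trans (by omega))
  · have := hx 0; omega
  · have := hx 0; omega
  · exact (uDiv_le _ _).trans ((hx 0).trans (by omega))
  · exact (uRoot_le _ _).trans ((hx 0).trans (by omega))
  · have := hx 0; have := hx 1; omega
  · exact (uCount_le _ _).trans ((hx 0).trans (by omega))
  · have := hx 0; have := hx 1; omega

/-- Each function symbol contributes at most one factor `2`. Without multiplication there is no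
faster growth, so the exponent is linear in the size of the term. -/
theorem realize_le_of_over {P : Type} {n : ℕ} {U : Set P} {π : P → ℕ} {x : Fin n → ℕ} {V : ℕ}
    (hV : 2 ≤ V) (hπ : ∀ u ∈ U, π u ≤ V) (hx : ∀ i, x i ≤ V) {t : ULang.Term (P ⊕ Fin n)}
    (ht : TermOver U t) : t.realize (Sum.elim π x) ≤ V * 2 ^ termSymbols t := by
  induction t with
  | var z =>
    rcases z with p | i
    · simpa [termSymbols] using hπ p ht
    · simpa [termSymbols] using hx i
  | @func l f ts ih =>
    have hM : 2 ≤ V * 2 ^ ∑ i, termSymbols (ts i) :=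
      hV.trans (Nat.le_mul_of_pos_right _ (by positivity))
    refine (USymbol.value_le f _ hM fun i => ?_).trans_eq ?_
    · refine (ih i (ht i)).trans (Nat.mul_le_mul_left _ (Nat.pow_le_pow_right (by norm_num) ?_))
      exact Finset.single_le_sum (f := fun i => termSymbols (ts i))
        (fun _ _ => Nat.zero_le _) (Finset.mem_univ i)
    · rw [termSymbols, mul_assoc, ← pow_add, add_comm]

end Growth

/-! ### Soundness of tableaux on an initial segment -/

section Soundness

/-- The condition kept along a branch: the formula is universal and holds when its unbounded
quantifiers range over `D`, or existential with witnesses up to `V₀`. -/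
structure Fml.Admissible (D : Set ℕ) (V₀ : ℕ) (U : Set ℕ) (π : ℕ → ℕ)
    (A : ParSentence ULang) : Prop where
  isOver : A.Over U
  holds : (A.IsUniversal ∧ A.Holds D π Fin.elim0) ∨
    (A.IsExistential ∧ A.Holds {v | v ≤ V₀} π Fin.elim0)

variable {D : Set ℕ} {V₀ : ℕ} {U : Set ℕ} {π : ℕ → ℕ}

theorem Fml.FullyBounded.admissible_iff {A : ParSentence ULang} (hA : A.FullyBounded) :
    A.Admissible D V₀ U π ↔ A.Over U ∧ A.Holds D π Fin.elim0 := by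
  refine ⟨fun h => ⟨h.isOver, ?_⟩, fun h => ⟨h.1, .inl ⟨hA.isUniversal, h.2⟩⟩⟩
  rcases h.holds with h | h
  · exact h.2
  · exact (hA.holds_congr _ _ _ _).1 h.2

theorem Fml.Admissible.congr {U' : Set ℕ} {π' : ℕ → ℕ} (hU : U ⊆ U') (hπ : Set.EqOn π π' U)
    {A : ParSentence ULang} (h : A.Admissible D V₀ U π) : A.Admissible D V₀ U' π' where
  isOver := h.isOver.mono hU
  holds := h.holds.imp (fun H => ⟨H.1, (h.isOver.holds_congr hπ D _).1 H.2⟩)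
    fun H => ⟨H.1, (h.isOver.holds_congr hπ _ _).1 H.2⟩

/-- Admissible formulas are prenex in their unbounded quantifiers, so the connective rules only ever
meet formulas whose truth is independent of the range `D`. -/
theorem Fml.Admissible.fullyBounded {A : ParSentence ULang} (h : A.Admissible D V₀ U π)
    (h₁ : ∀ B, A ≠ .all B) (h₂ : ∀ B, A ≠ .ex B) : A.FullyBounded := by
  rcases h.holds with H | H
  · cases A <;> first | exact H.1 | exact (h₁ _ rfl).elim
  · cases A <;> first | exact H.1 | exact (h₂ _ rfl).elim

/-- One step of a non-branching rule: the conclusion is admissible after the new parameter symbol,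
if any, has been given a suitable value. -/
theorem Rule.admissible {A B : ParSentence ULang} {u : Option ℕ} {V : ℕ} (hr : Rule U B u A)
    (hD : IsLowerSet D) (hV : 2 ≤ V) (hV₀ : V₀ ≤ V) (hπ : ∀ w ∈ U, π w ≤ V)
    (hVD : V * 2 ^ A.symbols ∈ D) (hB : B.Admissible D V₀ U π) :
    ∃ π' : ℕ → ℕ, Set.EqOn π π' U ∧ (∀ w, u = some w → π' w ≤ V * 2 ^ A.symbols) ∧
      A.Admissible D V₀ {w | u = some w ∨ w ∈ U} π' := by
  have hnone : ∀ {A : ParSentence ULang}, A.Admissible D V₀ U π →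
      A.Admissible D V₀ {w | (none : Option ℕ) = some w ∨ w ∈ U} π := fun h =>
    h.congr (fun _ hw => .inr hw) fun _ _ => rfl
  have hle : ∀ {t : ULang.Term (ℕ ⊕ Fin 0)}, TermOver U t →
      t.realize (Sum.elim π Fin.elim0) ≤ V * 2 ^ termSymbols t := fun ht =>
    realize_le_of_over hV hπ (fun i => i.elim0) ht
  -- The new parameter `u` is assigned a witness `w`; as `u ∉ U`, the old valuation is unchanged on
  -- `U`.
  have hnew : ∀ {u : ℕ} (C : Fml ULang ℕ 1) (w : ℕ) (D : Set ℕ), u ∉ U → C.Over U →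
      C.Holds D π (Fin.snoc (α := fun _ => ℕ) Fin.elim0 w) →
      Set.EqOn π (Function.update π u w) U ∧ (C.inst (parTerm u)).Over {z | some u = some z ∨ z ∈ U} ∧
      (C.inst (parTerm u)).Holds D (Function.update π u w) Fin.elim0 := by
    intro u C w D hu hC h
    have he : Set.EqOn π (Function.update π u w) U := fun z hz => by
      rw [Function.update_of_ne]; rintro rfl; exact hu hz
    refine ⟨he, (hC.mono fun _ hw => .inr hw).inst (.inl rfl), ?_⟩
    rw [Fml.holds_inst]
    have : (parTerm u : ULang.Term (ℕ ⊕ Fin 0)).realize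
        (Sum.elim (Function.update π u w) Fin.elim0) = w := by
      rw [parTerm, Term.realize_var]
      exact Function.update_self u w π
    rw [this]
    exact (hC.holds_congr he D _).1 h
  cases hr with
  | and_left _ C =>
    have hb := hB.fullyBounded (by simp) (by simp)
    obtain ⟨ho, hh⟩ := hb.admissible_iff.1 hB
    exact ⟨π, fun _ _ => rfl, by simp, hnone (hb.1.admissible_iff.2 ⟨ho.1, hh.1⟩)⟩
  | and_right C _ =>
    have hb := hB.fullyBounded (by simp) (by simp)
    obtain ⟨ho, hh⟩ := hb.admissible_iff.1 hB
    exact ⟨π, fun _ _ => rfl, by simp, hnone (hb.2.admissible_iff.2 ⟨ho.2, hh.2⟩)⟩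
  | neg_neg =>
    have hb := hB.fullyBounded (by simp) (by simp)
    obtain ⟨ho, hh⟩ := hb.admissible_iff.1 hB
    exact ⟨π, fun _ _ => rfl, by simp,
      hnone ((show A.FullyBounded from hb).admissible_iff.2 ⟨ho, not_not.1 hh⟩)⟩
  | neg_or C C' =>
    have hb := hB.fullyBounded (by simp) (by simp)
    obtain ⟨ho, hh⟩ := hb.admissible_iff.1 hB
    refine ⟨π, fun _ _ => rfl, by simp,
      hnone ((show (Fml.and C.neg C'.neg).FullyBounded from hb).admissible_iff.2 ⟨ho, ?_⟩)⟩
    simpa [Fml.Holds] using hh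
  | neg_imp C C' =>
    have hb := hB.fullyBounded (by simp) (by simp)
    obtain ⟨ho, hh⟩ := hb.admissible_iff.1 hB
    refine ⟨π, fun _ _ => rfl, by simp,
      hnone ((show (Fml.and C C'.neg).FullyBounded from hb).admissible_iff.2 ⟨ho, ?_⟩)⟩
    simpa [Fml.Holds] using hh
  | neg_and C C' =>
    have hb := hB.fullyBounded (by simp) (by simp)
    obtain ⟨ho, hh⟩ := hb.admissible_iff.1 hB
    refine ⟨π, fun _ _ => rfl, by simp,
      hnone ((show (Fml.or C.neg C'.neg).FullyBounded from hb).admissible_iff.2 ⟨ho, ?_⟩)⟩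
    simp only [Fml.Holds] at hh ⊢
    tauto
  | neg_ex => exact (hB.fullyBounded (by simp) (by simp)).elim
  | neg_all => exact (hB.fullyBounded (by simp) (by simp)).elim
  | neg_bex s C =>
    have hb := hB.fullyBounded (by simp) (by simp)
    obtain ⟨ho, hh⟩ := hb.admissible_iff.1 hB
    refine ⟨π, fun _ _ => rfl, by simp,
      hnone ((show (Fml.ball s C.neg).FullyBounded from hb).admissible_iff.2 ⟨ho, ?_⟩)⟩
    simpa [Fml.Holds] using hh
  | neg_ball s C =>
    have hb := hB.fullyBounded (by simp) (by simp)
    obtain ⟨ho, hh⟩ := hb.admissible_iff.1 hB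
    refine ⟨π, fun _ _ => rfl, by simp,
      hnone ((show (Fml.bex s C.neg).FullyBounded from hb).admissible_iff.2 ⟨ho, ?_⟩)⟩
    simpa [Fml.Holds] using hh
  | ex C u hu =>
    obtain ⟨ho, ⟨H, -⟩ | ⟨H, w, hw, hh⟩⟩ := hB
    · exact H.elim
    obtain ⟨h₁, h₂, h₃⟩ := hnew C w _ hu ho hh
    refine ⟨Function.update π u w, h₁, ?_, h₂, .inr ⟨Fml.IsExistential.subst (A := C) H _, h₃⟩⟩
    intro z hz
    cases hz
    rw [Function.update_self]
    exact (show w ≤ V₀ from hw).trans (hV₀.trans (Nat.le_mul_of_pos_right _ (by positivity)))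
  | bex s C u hu =>
    have hb := hB.fullyBounded (by simp) (by simp)
    obtain ⟨ho, w, hw, hh⟩ := hb.admissible_iff.1 hB
    obtain ⟨h₁, h₂, h₃⟩ := hnew C w _ hu ho.2 hh
    have hi : (C.inst (parTerm u)).FullyBounded := Fml.FullyBounded.subst (A := C) hb _
    refine ⟨Function.update π u w, h₁, ?_,
      (show (Fml.and (.le (parTerm u) s) (C.inst (parTerm u))).FullyBounded from
        ⟨trivial, hi⟩).admissible_iff.2
        ⟨⟨⟨.inl rfl, ho.1.mono fun _ hz => .inr hz⟩, h₂⟩, ?_, h₃⟩⟩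
    · intro z hz
      cases hz
      rw [Function.update_self]
      -- The witness is at most the value of `s`, and `s` reappears in the conclusion `u ≤ s ∧
      -- C(u)`, so its symbols are paid for there.
      refine (hw.trans (hle ho.1)).trans (Nat.mul_le_mul_left _ (Nat.pow_le_pow_right (by norm_num) ?_))
      simp only [Fml.symbols]
      omega
    · change _ ≤ _
      rw [← ho.1.realize_congr h₁]
      exact (Function.update_self u w π).trans_le hw
  | all C t ht =>
    obtain ⟨ho, ⟨H, hh⟩ | ⟨H, -⟩⟩ := hB
    · refine ⟨π, fun _ _ => rfl, by simp,
        hnone ⟨Fml.Over.inst ho ht.termOver, .inl ⟨Fml.IsUniversal.subst (A := C) H _, ?_⟩⟩⟩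
      rw [Fml.holds_inst]
      -- Either `t` is visible in the conclusion and its value lies in `D`, or any element of `D`
      -- serves in its place, for instance the bound itself.
      rcases C.symbols_le_or_holds_inst t π with h | h
      · exact hh _ (hD ((hle ht.termOver).trans
          (Nat.mul_le_mul_left _ (Nat.pow_le_pow_right (by norm_num) h))) hVD)
      · exact h _ _ _ (hh _ hVD)
    · exact H.elim
  | ball s C t ht =>
    have hb := hB.fullyBounded (by simp) (by simp)
    obtain ⟨ho, hh⟩ := hb.admissible_iff.1 hB
    have hi : (C.inst t).FullyBounded := Fml.FullyBounded.subst (A := C) hb _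
    refine ⟨π, fun _ _ => rfl, by simp,
      hnone ((show (Fml.imp (.le t s) (C.inst t)).FullyBounded from
        ⟨trivial, hi⟩).admissible_iff.2
        ⟨⟨⟨ht.termOver, ho.1⟩, Fml.Over.inst ho.2 ht.termOver⟩, fun h => ?_⟩)⟩
    rw [Fml.holds_inst]
    -- No bound on `t` is needed here: the conclusion is an implication whose premise `t ≤ s`
    -- supplies it.
    exact hh _ h

/-- A candidate tree above which all formulas are admissible, and in which not enough function
symbols occur to leave `D`, has an open branch. -/
theorem Tree.not_closed_of_admissible {α : Set (Sentence ULang)} (hD : IsLowerSet D)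
    (hα : ∀ A ∈ α, A.IsUniversal ∧ A.Holds D Empty.elim Fin.elim0) (T : Tree ULang)
    {Γ : Set (ParSentence ULang)} {V : ℕ} (hV : 2 ≤ V) (hV₀ : V₀ ≤ V)
    (hπ : ∀ w ∈ U, π w ≤ V) (hVD : V * 2 ^ T.symbols ∈ D)
    (hΓ : ∀ A ∈ Γ, A.Admissible D V₀ U π) (hT : T.IsCandidate α Γ U) : ¬ T.Closed Γ := by
  have grow : ∀ {V k : ℕ}, V ≤ V * 2 ^ k := Nat.le_mul_of_pos_right _ (by positivity)
  induction T generalizing Γ U π V with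
  | leaf =>
    rintro ⟨A, hA, hA'⟩
    -- Admissibility of `¬A` forces `A` to be bounded, so the two contradictory formulas are
    -- evaluated in the same way.
    have hb : A.FullyBounded := (hΓ _ hA').fullyBounded (by simp) (by simp)
    exact ((Fml.FullyBounded.admissible_iff (A := .neg A) hb).1 (hΓ _ hA')).2
      (hb.admissible_iff.1 (hΓ _ hA)).2
  | single u A T ih =>
    obtain ⟨hA, hT⟩ := hT
    -- The symbols of this node are moved from the remaining exponent into the bound on parameters;
    -- the total stays in `D`.
    have hsplit : V * 2 ^ (Tree.single u A T).symbols = V * 2 ^ A.symbols * 2 ^ T.symbols := by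
      rw [Tree.symbols, pow_add, mul_assoc]
    rw [hsplit] at hVD
    have hVA : V * 2 ^ A.symbols ∈ D := hD grow hVD
    obtain ⟨π', h₁, h₂, h₃⟩ : ∃ π' : ℕ → ℕ, Set.EqOn π π' U ∧
        (∀ w, u = some w → π' w ≤ V * 2 ^ A.symbols) ∧
        A.Admissible D V₀ {w | u = some w ∨ w ∈ U} π' := by
      rcases hA with ⟨rfl, B, hB, rfl⟩ | ⟨B, hB, hr⟩
      · refine ⟨π, fun _ _ => rfl, by simp, B.over_toPar _, .inl ⟨(hα B hB).1.subst _, ?_⟩⟩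
        exact (Fml.holds_toPar _ _ _ _).2 (hα B hB).2
      · exact hr.admissible hD hV hV₀ hπ hVA (hΓ B hB)
    refine ih (hV.trans grow) (hV₀.trans grow) (π := π') ?_ hVD ?_ hT
    · rintro w (hw | hw)
      · exact h₂ w hw
      · exact (h₁ hw ▸ hπ w hw).trans grow
    · rintro C (rfl | hC)
      · exact h₃
      · exact (hΓ C hC).congr (fun _ hw => .inr hw) h₁
  | pair A T A' T' ih ih' =>
    obtain ⟨⟨B, hB, hr⟩, hT, hT'⟩ := hT
    rintro ⟨hc, hc'⟩
    have hb : B.FullyBounded := by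
      cases hr <;> exact (hΓ _ hB).fullyBounded (by simp) (by simp)
    obtain ⟨ho, hh⟩ := hb.admissible_iff.1 (hΓ B hB)
    have key : A.Admissible D V₀ U π ∨ A'.Admissible D V₀ U π := by
      cases hr with
      | or =>
        exact hh.imp (fun h => hb.1.admissible_iff.2 ⟨ho.1, h⟩)
          fun h => hb.2.admissible_iff.2 ⟨ho.2, h⟩
      | imp C _ =>
        by_cases h : C.Holds D π Fin.elim0
        · exact .inr (hb.2.admissible_iff.2 ⟨ho.2, hh h⟩)
        · exact .inl ((show (Fml.neg C).FullyBounded from hb.1).admissible_iff.2 ⟨ho.1, h⟩)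
    have hle : ∀ {k : ℕ}, k ≤ (Tree.pair A T A' T').symbols → V * 2 ^ k ∈ D := fun h =>
      hD (Nat.mul_le_mul_left _ (Nat.pow_le_pow_right (by norm_num) h)) hVD
    rcases key with h | h
    · refine ih hV hV₀ hπ (hle (by simp only [Tree.symbols]; omega)) ?_ hT hc
      rintro C (rfl | hC); exacts [h, hΓ C hC]
    · refine ih' hV hV₀ hπ (hle (by simp only [Tree.symbols]; omega)) ?_ hT' hc'
      rintro C (rfl | hC); exacts [h, hΓ C hC]

/-- If all axioms hold on `D` and the tableau is too small to leave `D`, then the negation of the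
theorem is neither universal and true on `D` nor existential with witnesses up to `V₀`. -/
theorem IsTableauProof.not_reverse {α : Set (Sentence ULang)} {A : Sentence ULang}
    {p : Tableau ULang} (hp : IsTableauProof α A p) (hD : IsLowerSet D)
    (hα : ∀ A ∈ α, A.IsUniversal ∧ A.Holds D Empty.elim Fin.elim0) (hV : 2 ≤ V₀)
    (hVD : V₀ * 2 ^ p.symbols ∈ D) :
    ¬ ((A.reverse.IsUniversal ∧ A.reverse.Holds D Empty.elim Fin.elim0) ∨
      (A.reverse.IsExistential ∧ A.reverse.Holds {v | v ≤ V₀} Empty.elim Fin.elim0)) := by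
  intro h
  obtain ⟨hroot, hT, hc⟩ := hp
  refine Tree.not_closed_of_admissible (V₀ := V₀) (π := fun _ => 0) hD hα p.below hV le_rfl
    (by simp) (hD (Nat.mul_le_mul_left _ (Nat.pow_le_pow_right (by norm_num)
      (Nat.le_add_left _ _))) hVD) ?_ hT hc
  rintro _ rfl
  rw [hroot]
  refine ⟨Fml.over_toPar _ _, h.imp (fun H => ⟨H.1.subst _, ?_⟩) fun H => ⟨H.1.subst _, ?_⟩⟩
  all_goals exact (Fml.holds_toPar _ _ _ _).2 H.2

end Soundness

/-! ### Closed instances with numerals -/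

section Numerals

/-- A closed term with value `n`. -/
def numeral (X : Type) : ℕ → ULang.Term X
  | 0 => Term.func (USymbol.K0 : ULang.Functions 0) ![]
  | n + 1 => uAdd (numeral X n) (Term.func (USymbol.K1 : ULang.Functions 0) ![])

theorem numeral_subst {X Y : Type} (σ : X → ULang.Term Y) (n : ℕ) :
    (numeral X n).subst σ = numeral Y n := by
  have h : ∀ f : ULang.Functions 0, (Term.func f ![] : ULang.Term X).subst σ = Term.func f ![] :=
    fun f => by rw [Term.subst]; congr 1; exact Subsingleton.elim _ _
  induction n with
  | zero => exact h _
  | succ n ih =>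
    rw [numeral, numeral, uAdd, uAdd, Term.subst]
    congr 1
    funext i
    refine Fin.cases ih (fun i => ?_) i
    rw [Subsingleton.elim i 0]
    exact h _

theorem realize_numeral {X : Type} (v : X → ℕ) (n : ℕ) : (numeral X n).realize v = n := by
  induction n with
  | zero => rfl
  | succ n ih =>
    change (numeral X n).realize v + 1 = n + 1
    rw [ih]

theorem parsIn_numeral (n : ℕ) : ParsIn ∅ (numeral (ℕ ⊕ Fin 0) n) := by
  have h : ∀ z, z ∉ (numeral (ℕ ⊕ Fin 0) n).varFinset := by
    intro z
    induction n with
    | zero => simp [numeral, Term.varFinset]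
    | succ n ih => simp [numeral, uAdd, Term.varFinset, ih]
  exact fun u hu => (h _ hu).elim

/-- The numerals of the entries of `x` are put for the free variables of a formula. -/
def numeralSubst (Q : Type) {n : ℕ} (x : Fin n → ℕ) : Empty ⊕ Fin n → ULang.Term (Q ⊕ Fin 0) :=
  Sum.elim Empty.elim fun i => numeral _ (x i)

theorem toPar_eq_subst (A : Sentence ULang) (x : Fin 0 → ℕ) :
    A.toPar = A.subst (numeralSubst ℕ x) := by
  rw [Fml.toPar]
  congr 1
  funext z
  rcases z with p | i
  exacts [p.elim, i.elim0]

theorem toPar_subst_numeralSubst {n : ℕ} (A : Fml ULang Empty n) (x : Fin n → ℕ) :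
    Fml.toPar (A.subst (numeralSubst Empty x)) = A.subst (numeralSubst ℕ x) := by
  rw [Fml.toPar, Fml.subst_subst]
  congr 1
  funext z
  rcases z with p | i
  exacts [p.elim, numeral_subst _ _]

theorem inst_numeral {n : ℕ} (A : Fml ULang Empty (n + 1)) (x : Fin n → ℕ) (v : ℕ) :
    (A.subst (liftSubst (numeralSubst ℕ x))).inst (numeral _ v) =
      A.subst (numeralSubst ℕ (Fin.snoc (α := fun _ => ℕ) x v)) := by
  rw [Fml.inst, Fml.subst_subst]
  congr 1
  funext z
  rcases z with p | i
  · exact p.elim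
  · refine Fin.lastCases ?_ (fun i => ?_) i
    · simp [liftSubst, numeralSubst, Term.subst]
    · simp [liftSubst, numeralSubst, subst_relabel, numeral_subst]

theorem holds_subst_numeralSubst {n : ℕ} (D : Set ℕ) (A : Fml ULang Empty n) (x : Fin n → ℕ) :
    (A.subst (numeralSubst Empty x)).Holds D Empty.elim Fin.elim0 ↔ A.Holds D Empty.elim x := by
  rw [Fml.holds_subst]
  exact iff_of_eq (congrArg₂ (fun ρ y => A.Holds D ρ y) (funext fun p : Empty => p.elim)
    (funext fun i => realize_numeral _ _))

theorem AllBlock.isUniversal {n : ℕ} {A : Fml ULang Empty n} (h : AllBlock UDelta0 n A) :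
    A.IsUniversal := by
  induction h with
  | base h => exact Fml.FullyBounded.isUniversal h
  | all _ ih => exact ih

theorem ExBlock.isExistential {n : ℕ} {A : Fml ULang Empty n} (h : ExBlock UDelta0 n A) :
    A.IsExistential := by
  induction h with
  | base h => exact Fml.FullyBounded.isExistential h
  | ex _ ih => exact ih

end Numerals

/-! ### Truth of the base axioms -/

section Refutation

variable {α : Set (Sentence ULang)}

/-- The formulas in `Γ` can be extended to a closed candidate tree. -/
def Refutable (α : Set (Sentence ULang)) (Γ : Set (ParSentence ULang)) (U : Set ℕ) : Prop :=
  ∃ T : Tree ULang, T.IsCandidate α Γ U ∧ T.Closed Γ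

theorem setOf_none_or (U : Set ℕ) : {w | (none : Option ℕ) = some w ∨ w ∈ U} = U := by
  ext; simp

theorem Refutable.of_insert_mem {Γ : Set (ParSentence ULang)} {U : Set ℕ} {A : Sentence ULang}
    (hA : A ∈ α) (h : Refutable α (insert A.toPar Γ) U) : Refutable α Γ U := by
  obtain ⟨T, hT, hc⟩ := h
  refine ⟨.single none A.toPar T, ⟨.inl ⟨rfl, A, hA, rfl⟩, ?_⟩, hc⟩
  rwa [setOf_none_or]

theorem Refutable.of_insert_rule {Γ : Set (ParSentence ULang)} {U : Set ℕ} {A B : ParSentence ULang}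
    (hB : B ∈ Γ) (hr : Rule U B none A) (h : Refutable α (insert A Γ) U) : Refutable α Γ U := by
  obtain ⟨T, hT, hc⟩ := h
  refine ⟨.single none A T, ⟨.inr ⟨B, hB, hr⟩, ?_⟩, hc⟩
  rwa [setOf_none_or]

theorem Fml.ne_neg_self {n : ℕ} (A : Fml ULang ℕ n) : A ≠ .neg A := fun h => by
  have := congrArg sizeOf h
  simp at this

/-- A refutation that uses `¬¬A` can be turned into one that uses `A`. -/
theorem Refutable.of_neg_neg {A : ParSentence ULang} (T : Tree ULang)
    {Γ Γ' : Set (ParSentence ULang)} {U : Set ℕ} (hΓ : ∀ C ∈ Γ, C ∈ Γ' ∨ C = .neg (.neg A))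
    (hA : A ∈ Γ') (hT : T.IsCandidate α Γ U) (hc : T.Closed Γ) : Refutable α Γ' U := by
  have hins : ∀ {Γ Γ' : Set (ParSentence ULang)} {B : ParSentence ULang},
      (∀ C ∈ Γ, C ∈ Γ' ∨ C = .neg (.neg A)) →
      ∀ C ∈ insert B Γ, C ∈ insert B Γ' ∨ C = .neg (.neg A) := by
    rintro Γ Γ' B h C (rfl | hC)
    exacts [.inl (.inl rfl), (h C hC).imp_left .inr]
  induction T generalizing Γ Γ' U with
  | leaf =>
    obtain ⟨C, hC, hC'⟩ := hc
    rcases hΓ C hC with h | rfl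
    · rcases hΓ _ hC' with h' | h'
      · exact ⟨.leaf, trivial, C, h, h'⟩
      · cases h'
        exact ⟨.leaf, trivial, A, hA, h⟩
    · rcases hΓ _ hC' with h' | h'
      -- The branch was closed by `¬¬A` and `¬¬¬A`; one double-negation step yields `¬A`, which
      -- closes against `A`.
      · exact .of_insert_rule h' (.neg_neg _) ⟨.leaf, trivial, A, .inr hA, .inl rfl⟩
      · exact (Fml.ne_neg_self _ h'.symm).elim
  | single u B T ih =>
    obtain ⟨hB, hT⟩ := hT
    rcases hB with hB | ⟨C, hC, hr⟩
    · obtain ⟨T', hT', hc'⟩ := ih (hins hΓ) (.inr hA) hT hc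
      exact ⟨.single u B T', ⟨.inl hB, hT'⟩, hc'⟩
    · rcases hΓ C hC with h | rfl
      · obtain ⟨T', hT', hc'⟩ := ih (hins hΓ) (.inr hA) hT hc
        exact ⟨.single u B T', ⟨.inr ⟨C, h, hr⟩, hT'⟩, hc'⟩
      -- Only double-negation elimination applies to `¬¬A`. Its conclusion `A` is already available,
      -- so the node is dropped.
      · cases hr
        refine ih ?_ hA (setOf_none_or U ▸ hT) hc
        rintro C (rfl | hC')
        exacts [.inl hA, hΓ C hC']
  | pair B T B' T' ih ih' =>
    obtain ⟨⟨C, hC, hr⟩, hT, hT'⟩ := hT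
    obtain ⟨T₁, hT₁, hc₁⟩ := ih (hins hΓ) (.inr hA) hT hc.1
    obtain ⟨T₂, hT₂, hc₂⟩ := ih' (hins hΓ) (.inr hA) hT' hc.2
    rcases hΓ C hC with h | rfl
    · exact ⟨.pair B T₁ B' T₂, ⟨⟨C, h, hr⟩, hT₁, hT₂⟩, hc₁, hc₂⟩
    · cases hr

/-- The same tree works, since extra ancestors obstruct neither rules nor closure. The set `U` is
kept fixed because enlarging it could destroy the freshness of parameters. -/
theorem Refutable.mono {Γ Γ' : Set (ParSentence ULang)} {U : Set ℕ} (h : Γ ⊆ Γ')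
    (hr : Refutable α Γ U) : Refutable α Γ' U := by
  obtain ⟨T, hT, hc⟩ := hr
  refine ⟨T, ?_⟩
  induction T generalizing Γ Γ' U with
  | leaf => obtain ⟨A, hA, hA'⟩ := hc; exact ⟨trivial, A, h hA, h hA'⟩
  | single u A T ih =>
    have := ih (Set.insert_subset_insert h) hT.2 hc
    exact ⟨⟨hT.1.imp_right fun ⟨B, hB, hr⟩ => ⟨B, h hB, hr⟩, this.1⟩, this.2⟩
  | pair A T A' T' ih ih' =>
    have h₁ := ih (Set.insert_subset_insert h) hT.2.1 hc.1
    have h₂ := ih' (Set.insert_subset_insert h) hT.2.2 hc.2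
    obtain ⟨B, hB, hr⟩ := hT.1
    exact ⟨⟨⟨B, h hB, hr⟩, h₁.1, h₂.1⟩, h₁.2, h₂.2⟩

/-- From a false universal formula a false closed instance of its matrix can be deduced. -/
theorem Fml.IsUniversal.exists_false_instance (α : Set (Sentence ULang)) {n : ℕ}
    {A : Fml ULang Empty n} (hA : A.IsUniversal) (x : Fin n → ℕ)
    (hx : ¬ A.Holds Set.univ Empty.elim x) :
    ∃ B : Sentence ULang, B.FullyBounded ∧ ¬ StdTrue B ∧
      ∀ Γ : Set (ParSentence ULang), A.subst (numeralSubst ℕ x) ∈ Γ →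
        Refutable α (insert B.toPar Γ) ∅ → Refutable α Γ ∅ := by
  induction A with
  | all A ih =>
    simp only [Fml.Holds, Set.mem_univ, true_implies, not_forall] at hx
    obtain ⟨v, hv⟩ := hx
    obtain ⟨B, hB, hB', hr⟩ := ih hA _ hv
    refine ⟨B, hB, hB', fun Γ hΓ h => ?_⟩
    refine .of_insert_rule hΓ (.all _ (numeral _ v) (parsIn_numeral v)) ?_
    rw [inst_numeral]
    exact hr _ (.inl rfl) (h.mono (Set.insert_subset_insert (Set.subset_insert _ _)))
  | _ =>
    refine ⟨_, Fml.FullyBounded.subst hA (numeralSubst Empty x),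
      fun h => hx ((holds_subst_numeralSubst _ _ _).1 h), fun Γ hΓ h => ?_⟩
    rwa [toPar_subst_numeralSubst, Set.insert_eq_of_mem hΓ] at h

/-- The axioms of a base system are true. -/
theorem IsBaseSystem.stdTrue {B : Set (Sentence ULang)} (hB : IsBaseSystem B) {A : Sentence ULang}
    (hA : A ∈ B) : StdTrue A := by
  by_contra hx
  obtain ⟨C, hC, hC', hr⟩ := (AllBlock.isUniversal (hB.pi_one A hA)).exists_false_instance B _ hx
  -- The tableau for `¬C` has root `¬¬C`. There is no cut rule, so it is rewritten as a refutation
  -- of `C` and grafted below the false instance `C` of the axiom, under the root `¬ 0 = 1`.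
  obtain ⟨p, hroot, hT, hc⟩ := hB.delta_zero_complete (.neg C) hC hC'
  have hroot' : p.root = .neg (.neg C.toPar) := hroot
  have h : Refutable B {zeroEqOne.reverse.toPar} ∅ := by
    refine .of_insert_mem hA (hr _ ?_ (.of_neg_neg p.below (A := C.toPar) ?_ (.inl rfl) hT hc))
    · rw [← toPar_eq_subst]; exact .inl rfl
    · rintro _ rfl
      exact .inr hroot'
  obtain ⟨T, hT, hc⟩ := h
  exact hB.consistent ⟨⟨_, T⟩, rfl, hT, hc⟩

end Refutation

/-! ### Goodness at finite and infinite levels -/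

section Goodness

theorem good_coe_iff (r : ℝ) (A : Sentence ULang) :
    Good (r : EReal) A ↔ A.Holds {v : ℕ | (v : ℝ) < 2 ^ r} Empty.elim Fin.elim0 := by
  have : {v : ℕ | ((v : ℝ) : EReal) < E (r : EReal)} = {v : ℕ | (v : ℝ) < 2 ^ r} := by
    ext v
    exact EReal.coe_lt_coe_iff
  rw [Good, this]

theorem good_natCast_iff (J : ℕ) (A : Sentence ULang) :
    Good ((J : ℝ) : EReal) A ↔ A.Holds {v : ℕ | v < 2 ^ J} Empty.elim Fin.elim0 := by
  rw [good_coe_iff]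
  have : {v : ℕ | (v : ℝ) < 2 ^ (J : ℝ)} = {v : ℕ | v < 2 ^ J} := by
    ext v
    simp only [Set.mem_ofPred_eq, Real.rpow_natCast]
    exact_mod_cast Iff.rfl
  rw [this]

theorem good_top_iff (A : Sentence ULang) : Good ⊤ A ↔ StdTrue A := by
  have : {v : ℕ | ((v : ℝ) : EReal) < E ⊤} = Set.univ :=
    Set.eq_univ_of_forall fun v => EReal.coe_lt_top _
  rw [Good, this, StdTrue]

/-- Goodness of universal sentences passes to smaller `J`, so the admissible levels form an initial
segment of ℕ, and a finite supremum is attained. -/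
theorem sharp_cases {θ : Set (Sentence ULang)} (hθ : ∀ A ∈ θ, A.IsUniversal) :
    sharp θ = ⊥ ∨ (∃ J : ℕ, sharp θ = ((J : ℝ) : EReal) ∧ ∀ A ∈ θ, Good ((J : ℝ) : EReal) A) ∨
      (sharp θ = ⊤ ∧ ∀ J : ℕ, ∀ A ∈ θ, Good ((J : ℝ) : EReal) A) := by
  have anti : ∀ {J K : ℕ}, J ≤ K → (∀ A ∈ θ, Good ((K : ℝ) : EReal) A) →
      ∀ A ∈ θ, Good ((J : ℝ) : EReal) A := fun {J K} hJK h A hA =>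
    (good_natCast_iff J A).2 ((hθ A hA).holds_anti
      (fun v (hv : v < 2 ^ J) => hv.trans_le (Nat.pow_le_pow_right (by norm_num) hJK))
      ((good_natCast_iff K A).1 (h A hA)))
  by_cases hall : ∀ J : ℕ, ∀ A ∈ θ, Good ((J : ℝ) : EReal) A
  · refine .inr (.inr ⟨?_, hall⟩)
    rw [EReal.eq_top_iff_forall_lt]
    intro y
    obtain ⟨J, hJ⟩ := exists_nat_gt y
    exact (EReal.coe_lt_coe_iff.2 hJ).trans_le (le_sSup ⟨J, rfl, hall J⟩)
  · obtain ⟨K, hK⟩ := not_forall.1 hall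
    by_cases hne : ∃ J : ℕ, ∀ A ∈ θ, Good ((J : ℝ) : EReal) A
    · have hbdd : BddAbove {J : ℕ | ∀ A ∈ θ, Good ((J : ℝ) : EReal) A} :=
        ⟨K, fun J hJ => not_lt.1 fun h => hK (anti h.le hJ)⟩
      have hmem := Nat.sSup_mem hne hbdd
      refine .inr (.inl ⟨_, le_antisymm (sSup_le ?_) (le_sSup ⟨_, rfl, hmem⟩), hmem⟩)
      rintro _ ⟨J, rfl, hJ⟩
      exact EReal.coe_le_coe_iff.2 (Nat.cast_le.2 (le_csSup hbdd hJ))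
    · refine .inl (sSup_eq_bot.2 ?_)
      rintro _ ⟨J, rfl, hJ⟩
      exact (hne ⟨J, hJ⟩).elim

end Goodness

/-! ### A-stability and E-stability -/

section Stability

variable {B θ : Set (Sentence ULang)} {A : Sentence ULang} {p : Tableau ULang} {J c : ℕ}

theorem IsBaseSystem.axioms_hold (hB : IsBaseSystem B) (hθ : ∀ A ∈ θ, A.IsUniversal)
    (hgood : ∀ A ∈ θ, Good ((J : ℝ) : EReal) A) {D : Set ℕ} (hD : D ⊆ {v | v < 2 ^ J}) :
    ∀ A ∈ θ ∪ B, A.IsUniversal ∧ A.Holds D Empty.elim Fin.elim0 := by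
  rintro A (hA | hA)
  · exact ⟨hθ A hA, (hθ A hA).holds_anti hD ((good_natCast_iff J A).1 (hgood A hA))⟩
  · have hu : A.IsUniversal := AllBlock.isUniversal (hB.pi_one A hA)
    exact ⟨hu, hu.holds_anti (Set.subset_univ D) (hB.stdTrue hA)⟩

theorem le_two_pow_of_logb_le (hc : Real.logb 2 c ≤ J + 1) : c ≤ 2 ^ (J + 1) := by
  rcases Nat.eq_zero_or_pos c with rfl | h
  · exact Nat.zero_le _
  rw [Real.logb_le_iff_le_rpow (by norm_num) (by exact_mod_cast h)] at hc
  exact_mod_cast hc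

/-- The bound is `J + 2` and not `J + 1` because `c = 2 ^ (J + 1)` is allowed. -/
theorem size_le_of_logb_le (hc : Real.logb 2 c ≤ J + 1) : Nat.size c ≤ J + 2 :=
  Nat.size_le.2 ((le_two_pow_of_logb_le hc).trans_lt (Nat.pow_lt_pow_right (by norm_num) (by omega)))

theorem IsBaseSystem.good_half (hB : IsBaseSystem B) (hθ : ∀ A ∈ θ, A.IsUniversal)
    (hgood : ∀ A ∈ θ, Good ((J : ℝ) : EReal) A) (hA : A.IsUniversal)
    (hp : IsTableauProof (θ ∪ B) A p) (hs : 5 * p.symbols ≤ Nat.size c) (hc : 64 ≤ Nat.size c)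
    (hlog : Real.logb 2 c ≤ J + 1) : Good (((J : ℝ) / 2 : ℝ) : EReal) A := by
  rw [good_coe_iff]
  by_contra hx
  have hJ := size_le_of_logb_le hlog
  -- The exponent is `J / 2` rounded up, so every witness below `2 ^ (J / 2)` is covered. With at
  -- most `(J + 2) / 5` function symbols, and `J ≥ 62` from the 64 bits, the sum of the exponents
  -- stays below `J`.
  refine hp.not_reverse (V₀ := 2 ^ ((J + 1) / 2)) (D := {v | v < 2 ^ J})
    (fun _ _ h h' => lt_of_le_of_lt h h') (hB.axioms_hold hθ hgood le_rfl)
    (Nat.le_self_pow (by omega) 2) ?_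
    (.inr ⟨hA.reverse, hA.reverse.holds_mono ?_ ((Fml.holds_reverse _ _ _ _).2 hx)⟩)
  · rw [Set.mem_ofPred_eq, ← pow_add]
    exact Nat.pow_lt_pow_right (by norm_num) (by omega)
  · intro v hv
    have h : (v : ℝ) < 2 ^ ((J : ℝ) / 2) := hv
    have h' : (J : ℝ) / 2 ≤ ((J + 1) / 2 : ℕ) := by
      have : (J : ℝ) ≤ 2 * ((J + 1) / 2 : ℕ) := by exact_mod_cast (by omega : J ≤ 2 * ((J + 1) / 2))
      linarith
    have h'' := h.le.trans (Real.rpow_le_rpow_of_exponent_le one_le_two h')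
    rw [Real.rpow_natCast] at h''
    exact_mod_cast h''

theorem IsBaseSystem.good_half_log (hB : IsBaseSystem B) (hθ : ∀ A ∈ θ, A.IsUniversal)
    (hgood : ∀ A ∈ θ, Good ((J : ℝ) : EReal) A) (hA : A.IsExistential)
    (hp : IsTableauProof (θ ∪ B) A p) (hs : 5 * p.symbols ≤ Nat.size c) (hc : 64 ≤ Nat.size c)
    (hlog : Real.logb 2 c ≤ J + 1) :
    Good (((⌊Real.logb 2 c⌋ : ℝ) / 2 - 1 : ℝ) : EReal) A := by
  have hfloor : (⌊Real.logb 2 c⌋ : ℝ) = (Nat.log 2 c : ℕ) := by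
    have := Real.floor_logb_natCast (b := 2) (r := (c : ℝ)) (Nat.cast_nonneg c)
    rw [Nat.cast_ofNat] at this
    rw [this, Int.log_natCast, Int.cast_natCast]
  have hsize : Nat.size c ≤ Nat.log 2 c + 1 :=
    Nat.size_le.2 (Nat.lt_pow_succ_log_self one_lt_two c)
  have hk : Nat.log 2 c ≤ J + 1 := by
    have := Nat.log_mono_right (b := 2) (le_two_pow_of_logb_le hlog)
    rwa [Nat.log_pow one_lt_two] at this
  rw [hfloor]
  generalize Nat.log 2 c = k at hsize hk
  rw [good_coe_iff]
  by_contra hx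
  -- No witness comes from the root, which is universal here; `2` is the least bound that covers the
  -- constants. The segment `D` lies below `2 ^ J` since `k ≤ J + 1`, and it contains `2 ^ (1 +
  -- p.symbols)` since `5 * p.symbols ≤ k + 1` and `k ≥ 63`.
  refine hp.not_reverse (V₀ := 2) (D := {v : ℕ | (v : ℝ) < 2 ^ ((k : ℝ) / 2 - 1)})
    (fun _ _ h h' => (Nat.cast_le (α := ℝ).2 h).trans_lt h') (hB.axioms_hold hθ hgood ?_) le_rfl ?_
    (.inl ⟨hA.reverse, (Fml.holds_reverse _ _ _ _).2 hx⟩)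
  · intro v hv
    have h : (v : ℝ) < 2 ^ ((k : ℝ) / 2 - 1) := hv
    have hk' : (k : ℝ) ≤ J + 1 := by exact_mod_cast hk
    have hk0 : (0 : ℝ) ≤ k := Nat.cast_nonneg k
    have h' := h.trans_le (Real.rpow_le_rpow_of_exponent_le one_le_two
      (by linarith : (k : ℝ) / 2 - 1 ≤ (J : ℕ)))
    rw [Real.rpow_natCast] at h'
    exact_mod_cast h'
  · have h : ((1 + p.symbols : ℕ) : ℝ) < (k : ℝ) / 2 - 1 := by
      have : (2 * (1 + p.symbols) + 2 : ℝ) < k := by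
        exact_mod_cast (by omega : 2 * (1 + p.symbols) + 2 < k)
      push_cast
      linarith
    have h' := Real.rpow_lt_rpow_of_exponent_lt one_lt_two h
    rw [Real.rpow_natCast, pow_add, pow_one] at h'
    rw [Set.mem_ofPred_eq]
    exact_mod_cast h'

theorem xiStar_aStable (g : Tableau ULang → ℕ) (hB : IsBaseSystem B)
    (hg : ConventionalEncoding g) : (xiStar B g).AStable := by
  rintro (θ : Set (Sentence ULang)) ⟨hθ, -⟩ (A : Sentence ULang) hA (p : Tableau ULang)
    (hp : IsTableauProof (θ ∪ B) A p) (hlog : ((Real.logb 2 (g p) : ℝ) : EReal) ≤ sharp θ + 1)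
  change Good (sharp θ / 2) A
  have hθ' : ∀ A ∈ θ, A.IsUniversal := fun A h => AllBlock.isUniversal (hθ A h)
  have hA' : A.IsUniversal := AllBlock.isUniversal hA
  obtain ⟨hs, hc⟩ := hg _ _ _ hp
  rcases sharp_cases hθ' with h | ⟨J, h, hJ⟩ | ⟨h, hJ⟩
  · rw [h, EReal.bot_add, le_bot_iff] at hlog
    exact (EReal.coe_ne_bot _ hlog).elim
  · rw [h] at hlog ⊢
    exact hB.good_half hθ' hJ hA' hp hs hc (by exact_mod_cast hlog)
  · rw [h, EReal.top_div_of_pos_ne_top (by norm_num) (by decide), good_top_iff]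
    obtain ⟨K, hK⟩ := exists_nat_ge (Real.logb 2 (g p))
    refine hA'.holds_univ fun k => ?_
    -- Every finite level is available. The summand `K` makes the level admissible for `p`, and `2 *
    -- k` survives the halving as `k`, so all `v < k < 2 ^ k` are covered.
    have := hB.good_half hθ' (hJ (K + 2 * k)) hA' hp hs hc (by push_cast; linarith)
    rw [good_coe_iff] at this
    refine hA'.holds_anti (fun v (hv : v < k) => ?_) this
    calc (v : ℝ) < (2 : ℝ) ^ k := by exact_mod_cast hv.trans k.lt_two_pow_self
      _ = 2 ^ (k : ℝ) := (Real.rpow_natCast _ _).symm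
      _ ≤ _ := Real.rpow_le_rpow_of_exponent_le one_le_two (by push_cast; linarith [K.cast_nonneg (α := ℝ)])

theorem xiStar_eStable (g : Tableau ULang → ℕ) (hB : IsBaseSystem B)
    (hg : ConventionalEncoding g) : (xiStar B g).EStable := by
  rintro (θ : Set (Sentence ULang)) ⟨hθ, -⟩ (A : Sentence ULang) hA (p : Tableau ULang)
    (hp : IsTableauProof (θ ∪ B) A p) (hlog : ((Real.logb 2 (g p) : ℝ) : EReal) ≤ sharp θ + 1)
  change Good (((⌊Real.logb 2 (g p)⌋ : ℝ) / 2 - 1 : ℝ) : EReal) A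
  have hθ' : ∀ A ∈ θ, A.IsUniversal := fun A h => AllBlock.isUniversal (hθ A h)
  have hA' : A.IsExistential := ExBlock.isExistential hA
  obtain ⟨hs, hc⟩ := hg _ _ _ hp
  rcases sharp_cases hθ' with h | ⟨J, h, hJ⟩ | ⟨h, hJ⟩
  · rw [h, EReal.bot_add, le_bot_iff] at hlog
    exact (EReal.coe_ne_bot _ hlog).elim
  · rw [h] at hlog
    exact hB.good_half_log hθ' hJ hA' hp hs hc (by exact_mod_cast hlog)
  · obtain ⟨K, hK⟩ := exists_nat_ge (Real.logb 2 (g p))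
    -- The conclusion depends only on `Log p`, so any finite level `K ≥ Log p` suffices.
    exact hB.good_half_log hθ' (hJ K) hA' hp hs hc (by linarith)

end Stability

end Willard

theorem theoremD4 (B : Set (Willard.Sentence Willard.ULang))
    (g : Willard.Tableau Willard.ULang → ℕ)
    (hB : Willard.IsBaseSystem B) (hg : Willard.ConventionalEncoding g) :
    (Willard.xiStar B g).AStable ∧ (Willard.xiStar B g).EStable ∧
      (Willard.xiStar B g).EAStable :=
  ⟨Willard.xiStar_aStable g hB hg, Willard.xiStar_eStable g hB hg,
    Willard.xiStar_eStable g hB hg, Willard.xiStar_aStable g hB hg⟩
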